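/- \textbf{Conventions.} All Hilbert spaces are finite-dimensional and complex. For a positive operator $\rho_{AB}$ on $\mathcal H_A\otimes\mathcal H_B$, $\rho_A=\operatorname{tr}_B\rho_{AB}$ and $\rho_B=\operatorname{tr}_A\rho_{AB}$. A normalized (subnormalized) state is a positive operator of trace $1$ (at most $1$). Put $\|M\|_1=\operatorname{tr}\sqrt{M^\dagger M}$. For subnormalized states let $$F(\rho,\sigma)=\|\sqrt\rho\sqrt\sigma\|_1,\qquad \bar F(\rho,\sigma)=F(\rho,\sigma)+\sqrt{(1-\operatorname{tr}\rho)(1-\operatorname{tr}\sigma)},\qquad P(\rho,\sigma)=\sqrt{1-\bar F(\rho,\sigma)^2}.$$ For a subnormalized state $\rho_{AB}$ and $\varepsilon\ge 0$ define, with values in $[-\infty,+\infty]$, $$H_{\min}(A|B)_\rho=\sup_{\sigma_B}\ \sup\{\lambda\in\mathbb R:\ 2^{-\lambda}\,\mathbb I_A\otimes\sigma_B-\rho_{AB}\ge 0\},\qquad H_{\min}^{\varepsilon}(A|B)_\rho=\sup_{\hat\rho_{AB}}H_{\min}(A|B)_{\hat\rho},$$ where $\sigma_B$ ranges over the normalized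 states on $\mathcal H_B$, and $\hat\rho_{AB}$ over the subnormalized states on $\mathcal H_A\otimes\mathcal H_B$ with $P(\hat\rho,\rho)\le\varepsilon$; moreover $2^{-\infty}=0$. Fix an orthonormal basis $\{|x\rangle\}$ of $\mathcal H_A$, let $|A|=\dim\mathcal H_A$, let $A'$ be a copy of $A$, and let $|\Phi\rangle_{A'A}=|A|^{-1/2}\sum_x|x\rangle_{A'}\otimes|x\rangle_A$. The Choi--Jamio\l{}kowski operator of a linear map $\mathcal T$ from operators on $\mathcal H_A$ to operators on $\mathcal H_B$ is $J(\mathcal T)=(\mathcal I_{A'}\otimes\mathcal T)(|\Phi\rangle\langle\Phi|_{A'A})$, an operator on $\mathcal H_{A'}\otimes\mathcal H_B\cong\mathcal H_A\otimes\mathcal H_B$. \textbf{Theorem (Decoupling theorem).} Let $\varepsilon>0$, let $\rho_{AE}$ be a normalized state on $\mathcal H_A\otimes\mathcal H_E$, and let $\mathcal T$ be a completely positive map from operators on $\mathcal H_A$ to operators on $\mathcal H_B$ whose Choi--Jamio\l{}kowski operator $\tau_{AB}=J(\mathcal T)$ satisfies $\operatorname{tr}(\tau_{AB})\le 1$. Then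 $$\int_{\mathbb U(A)}\left\|\mathcal T(U\rho_{AE}U^\dagger)-\tau_B\otimes\rho_E\right\|_1\,dU\ \le\ 2^{-\frac12 H_{\min}^{\varepsilon}(A|E)_\rho-\frac12 H_{\min}^{\varepsilon}(A|B)_\tau}+12\,\varepsilon,$$ where $dU$ is the normalized Haar measure on the group $\mathbb U(A)$ of unitaries on $\mathcal H_A$, $U$ acts as $U\otimes\mathbb I_E$, and $\mathcal T$ acts as $\mathcal T\otimes\mathcal I_E$. -/

import Mathlib

open MeasureTheory
open scoped Matrix Kronecker ENNReal ComplexOrder MatrixOrder Matrix.Norms.L2Operator CStarAlgebra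

/-! Finite-dimensional Hilbert spaces are `ℂ^A` for a finite index type `A` (the fixed orthonormal
basis), operators on them are `Matrix A A ℂ`, and the composite system `AB` has index type
`A × B`. -/

namespace Decoupling

noncomputable section

/-- Subnormalized states: positive operators of trace at most one. -/
def IsSubnormalized {A : Type*} [Fintype A] (ρ : Matrix A A ℂ) : Prop :=
  ρ.PosSemidef ∧ ρ.trace.re ≤ 1

/-- Normalized states: positive operators of trace one. -/
def IsNormalized {A : Type*} [Fintype A] (ρ : Matrix A A ℂ) : Prop :=
  ρ.PosSemidef ∧ ρ.trace = 1

/-- The reduced operator on the first factor. -/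
def reduceFst {A B : Type*} [Fintype B] (ρ : Matrix (A × B) (A × B) ℂ) : Matrix A A ℂ :=
  Matrix.of fun a a' => ∑ b, ρ (a, b) (a', b)

/-- The reduced operator on the second factor. -/
def reduceSnd {A B : Type*} [Fintype A] (ρ : Matrix (A × B) (A × B) ℂ) : Matrix B B ℂ :=
  Matrix.of fun b b' => ∑ a, ρ (a, b) (a, b')

/-- The trace norm `‖M‖₁ = tr √(M† M)`. -/
def traceNorm {A : Type*} [Fintype A] [DecidableEq A] (M : Matrix A A ℂ) : ℝ :=
  (Matrix.trace (CFC.sqrt (Mᴴ * M))).re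

/-- The fidelity `F(ρ, σ) = ‖√ρ √σ‖₁`. -/
def fidelity {A : Type*} [Fintype A] [DecidableEq A] (ρ σ : Matrix A A ℂ) : ℝ :=
  traceNorm (CFC.sqrt ρ * CFC.sqrt σ)

/-- The generalized fidelity of subnormalized states. -/
def genFidelity {A : Type*} [Fintype A] [DecidableEq A] (ρ σ : Matrix A A ℂ) : ℝ :=
  fidelity ρ σ + Real.sqrt ((1 - ρ.trace.re) * (1 - σ.trace.re))

/-- The purified distance of subnormalized states. -/
def purifiedDist {A : Type*} [Fintype A] [DecidableEq A] (ρ σ : Matrix A A ℂ) : ℝ :=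
  Real.sqrt (1 - genFidelity ρ σ ^ 2)

/-- The `ε`-ball of subnormalized states around `ρ` in purified distance. -/
def smoothingBall {A : Type*} [Fintype A] [DecidableEq A] (ε : ℝ) (ρ : Matrix A A ℂ) :
    Set (Matrix A A ℂ) :=
  {ρ' | IsSubnormalized ρ' ∧ purifiedDist ρ' ρ ≤ ε}

/-- The min-entropy `H_min(A|B)_ρ`, i.e. the supremum of all real `l` such that
`2^(-l) 1_A ⊗ σ_B - ρ_AB ≥ 0` for some normalized `σ_B`. It takes the value `⊤` at `ρ = 0`. -/
def minEntropy {A B : Type*} [Fintype A] [DecidableEq A] [Fintype B]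
    (ρ : Matrix (A × B) (A × B) ℂ) : EReal :=
  ⨆ (σ : Matrix B B ℂ) (_ : IsNormalized σ), ⨆ (l : ℝ)
    (_ : (((2 : ℝ) ^ (-l)) • ((1 : Matrix A A ℂ) ⊗ₖ σ) - ρ).PosSemidef), (l : EReal)

/-- The `ε`-smooth min-entropy `H_min^ε(A|B)_ρ`. -/
def smoothMinEntropy {A B : Type*} [Fintype A] [DecidableEq A] [Fintype B] [DecidableEq B]
    (ε : ℝ) (ρ : Matrix (A × B) (A × B) ℂ) : EReal :=
  ⨆ ρ' ∈ smoothingBall ε ρ, minEntropy ρ'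

/-- The function `x ↦ 2^x` on the extended reals. -/
def exp2 : EReal → ℝ≥0∞
  | ⊥ => 0
  | ⊤ => ⊤
  | (x : ℝ) => ENNReal.ofReal ((2 : ℝ) ^ x)

/-- The operator `|Φ⟩⟨Φ|` on `A' A`, where `Φ = |A|^(-1/2) ∑ x, |x⟩ ⊗ |x⟩`. -/
def maxEntangled (A : Type*) [Fintype A] [DecidableEq A] : Matrix (A × A) (A × A) ℂ :=
  let Φ : A × A → ℂ := fun p =>
    (((Real.sqrt (Fintype.card A))⁻¹ : ℝ) : ℂ) * if p.1 = p.2 then 1 else 0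
  Matrix.vecMulVec Φ (star Φ)

/-- `T ⊗ I_E`, acting on operators on `A E`. -/
def applyFst {A B : Type*} (E : Type*) (T : Matrix A A ℂ →ₗ[ℂ] Matrix B B ℂ)
    (X : Matrix (A × E) (A × E) ℂ) : Matrix (B × E) (B × E) ℂ :=
  Matrix.of fun p q => T (Matrix.of fun a a' => X (a, p.2) (a', q.2)) p.1 q.1

/-- `I_R ⊗ T`, acting on operators on `R A`. -/
def applySnd {A B : Type*} (R : Type*) (T : Matrix A A ℂ →ₗ[ℂ] Matrix B B ℂ)
    (X : Matrix (R × A) (R × A) ℂ) : Matrix (R × B) (R × B) ℂ :=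
  Matrix.of fun p q => T (Matrix.of fun a a' => X (p.1, a) (q.1, a')) p.2 q.2

/-- On product operators `T ⊗ I_E` acts as it should; by linearity this determines it. -/
theorem applyFst_kronecker {A B E : Type*} (T : Matrix A A ℂ →ₗ[ℂ] Matrix B B ℂ)
    (X : Matrix A A ℂ) (Y : Matrix E E ℂ) : applyFst E T (X ⊗ₖ Y) = T X ⊗ₖ Y := by
  ext p q
  have h : (Matrix.of fun a a' => (X ⊗ₖ Y) (a, p.2) (a', q.2)) = Y p.2 q.2 • X := by
    ext a a'
    simp [Matrix.kroneckerMap_apply, mul_comm]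
  rw [applyFst, Matrix.of_apply, h, map_smul, Matrix.smul_apply, smul_eq_mul, mul_comm]
  rfl

/-- On product operators `I_R ⊗ T` acts as it should; by linearity this determines it. -/
theorem applySnd_kronecker {A B R : Type*} (T : Matrix A A ℂ →ₗ[ℂ] Matrix B B ℂ)
    (Y : Matrix R R ℂ) (X : Matrix A A ℂ) : applySnd R T (Y ⊗ₖ X) = Y ⊗ₖ T X := by
  ext p q
  have h : (Matrix.of fun a a' => (Y ⊗ₖ X) (p.1, a) (q.1, a')) = Y p.1 q.1 • X := by
    ext a a'
    simp [Matrix.kroneckerMap_apply]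
  rw [applySnd, Matrix.of_apply, h, map_smul, Matrix.smul_apply, smul_eq_mul]
  rfl

/-- The Choi-Jamiołkowski representation `J(T) = (I_A' ⊗ T)(|Φ⟩⟨Φ|)`. -/
def choi {A B : Type*} [Fintype A] [DecidableEq A] (T : Matrix A A ℂ →ₗ[ℂ] Matrix B B ℂ) :
    Matrix (A × B) (A × B) ℂ :=
  applySnd A T (maxEntangled A)

instance {A : Type*} [Fintype A] [DecidableEq A] :
    MeasurableSpace (Matrix.unitaryGroup A ℂ) := borel _

instance {A : Type*} [Fintype A] [DecidableEq A] :
    BorelSpace (Matrix.unitaryGroup A ℂ) := ⟨rfl⟩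

instance {A : Type*} [Fintype A] [DecidableEq A] :
    CompactSpace (Matrix.unitaryGroup A ℂ) := by
  have : ProperSpace (Matrix A A ℂ) := FiniteDimensional.proper ℂ _
  refine isCompact_iff_compactSpace.1 (Metric.isCompact_of_isClosed_isBounded ?_ ?_)
  · exact isClosed_unitary (R := Matrix A A ℂ)
  · cases isEmpty_or_nonempty A
    · exact (Set.toFinite _).isBounded
    · refine (Metric.isBounded_iff_subset_closedBall (0 : Matrix A A ℂ)).2 ⟨1, fun U hU => ?_⟩
      rw [mem_closedBall_zero_iff]
      exact (CStarRing.norm_of_mem_unitary hU).le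

/-- The Haar measure on the unitary group, normalized to total mass one. -/
def haarUnitary (A : Type*) [Fintype A] [DecidableEq A] : Measure (Matrix.unitaryGroup A ℂ) :=
  Measure.haarMeasure ⊤

instance {A : Type*} [Fintype A] [DecidableEq A] : IsProbabilityMeasure (haarUnitary A) :=
  ⟨by simpa [haarUnitary] using
    Measure.haarMeasure_self (K₀ := (⊤ : TopologicalSpace.PositiveCompacts
      (Matrix.unitaryGroup A ℂ)))⟩

/-- The conjugate `U X U†` of an operator on `A E` by a unitary on `A`. -/
def conjFst {A E : Type*} [Fintype A] [DecidableEq A] [Fintype E] [DecidableEq E]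
    (U : Matrix.unitaryGroup A ℂ) (X : Matrix (A × E) (A × E) ℂ) : Matrix (A × E) (A × E) ℂ :=
  ((U : Matrix A A ℂ) ⊗ₖ (1 : Matrix E E ℂ)) * X * ((U : Matrix A A ℂ) ⊗ₖ (1 : Matrix E E ℂ))ᴴ

/-- The decoupling error `‖T(U ρ_AE U†) - τ_B ⊗ ρ_E‖₁`, where `τ_AB = J(T)`. -/
def decouplingError {A B E : Type*} [Fintype A] [DecidableEq A] [Fintype B] [DecidableEq B]
    [Fintype E] [DecidableEq E] (T : Matrix A A ℂ →ₗ[ℂ] Matrix B B ℂ)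
    (ρ : Matrix (A × E) (A × E) ℂ) (U : Matrix.unitaryGroup A ℂ) : ℝ :=
  traceNorm (applyFst E T (conjFst U ρ) - reduceSnd (choi T) ⊗ₖ reduceSnd ρ)

end

end Decoupling

/-! For an operator `C` on `AB` and an operator `X` on `AE`, let `D(U)` be `T(U X U†) - C_B ⊗ X_E`,
where `T` has Choi operator `C`; it is additive in each of `C` and `X`. Write `n = |A|`.

Hilbert-Schmidt estimate. Since `T(1) = n C_B`, subtracting the mean removes the trace from each
`A`-block of `X`. A unitarily invariant bilinear form is a combination of `tr (XY)` and `tr X tr Y`,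
and only the first survives on traceless blocks. So the Haar average of `‖D‖₂²` is `α` times the
squared norm of the traceless blocks, with `α (n³ - n) = n³ ‖C‖₂² - n² ‖C_B‖₂²`. For positive `C`,
`‖C‖₂² ≤ n ‖C_B‖₂²`; hence `α ≤ ‖C‖₂²` when `n > 1`, and the average is at most `‖C‖₂² ‖X‖₂²`
(`integral_hsNormSq_deviation_le`).

From Hilbert-Schmidt to trace norm. Let `C ≤ 2^(-l) 1 ⊗ ω` and `X ≤ 2^(-m) 1 ⊗ σ` with invertible
states `ω = K⁴`, `σ = K'⁴`. Conjugating `C` by `K⁻¹` and `X` by `K'⁻¹` gives squared norms at most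
`2^(-l)` and `2^(-m)`. Conjugating back by `K ⊗ K'` bounds the trace norm by the Hilbert-Schmidt
norm, because `tr (ω ⊗ σ) = 1`. This yields `2^(-(l+m)/2)`
(`integral_traceNorm_deviation_le_of_dominated`).

Smoothing. For positive operators the average of `‖D‖₁` is at most `2 tr C tr X`; Jordan
decomposition extends this to Hermitian differences. Purified distance `ε` gives trace distance at
most `2ε`, so replacing `X` and `C` by nearby operators costs `4ε` each. The resulting `8ε` is
within the allowed `12ε`. -/

namespace Decoupling

/-! ### Trace norm, Hilbert-Schmidt norm and polar decomposition -/

section TraceNorm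

variable {n m : Type*} [Fintype n] [Fintype m]

/-- The square of the Hilbert-Schmidt norm. -/
noncomputable def hsNormSq (M : Matrix m n ℂ) : ℝ := ∑ i, ∑ j, ‖M i j‖ ^ 2

theorem hsNormSq_nonneg (M : Matrix m n ℂ) : 0 ≤ hsNormSq M :=
  Finset.sum_nonneg fun _ _ => Finset.sum_nonneg fun _ _ => sq_nonneg _

theorem trace_conjTranspose_mul_self_eq (M : Matrix m n ℂ) :
    (Mᴴ * M).trace = (hsNormSq M : ℂ) := by
  simp only [Matrix.trace, Matrix.diag, Matrix.mul_apply, Matrix.conjTranspose_apply, hsNormSq]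
  rw [Finset.sum_comm]
  push_cast
  refine Finset.sum_congr rfl fun i _ => Finset.sum_congr rfl fun j _ => ?_
  rw [← Complex.conj_mul']
  rfl

theorem re_trace_conjTranspose (M : Matrix n n ℂ) : Mᴴ.trace.re = M.trace.re := by
  rw [Matrix.trace_conjTranspose, Complex.star_def, Complex.conj_re]

theorem trace_re_nonneg {ρ : Matrix n n ℂ} (hρ : ρ.PosSemidef) : 0 ≤ ρ.trace.re :=
  (Complex.nonneg_iff.1 hρ.trace_nonneg).1

theorem hsNormSq_eq_re_trace (M : Matrix m n ℂ) : hsNormSq M = (Mᴴ * M).trace.re := by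
  rw [trace_conjTranspose_mul_self_eq, Complex.ofReal_re]

theorem hsNormSq_conjTranspose (M : Matrix m n ℂ) : hsNormSq Mᴴ = hsNormSq M := by
  simp only [hsNormSq, Matrix.conjTranspose_apply, norm_star]
  exact Finset.sum_comm

theorem norm_trace_mul_le (X : Matrix m n ℂ) (Y : Matrix n m ℂ) :
    ‖(X * Y).trace‖ ≤ √(hsNormSq X) * √(hsNormSq Y) := by
  simp only [Matrix.trace, Matrix.diag, Matrix.mul_apply]
  rw [← hsNormSq_conjTranspose Y]
  simp only [hsNormSq, Matrix.conjTranspose_apply, norm_star]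
  rw [← Finset.sum_product', ← Finset.sum_product', ← Finset.sum_product']
  refine (norm_sum_le _ _).trans ?_
  simp only [norm_mul]
  exact Real.sum_mul_le_sqrt_mul_sqrt _ _ _

theorem hsNormSq_of_isHermitian {R : Matrix n n ℂ} (hR : R.IsHermitian) :
    hsNormSq R = (R * R).trace.re := by
  rw [hsNormSq_eq_re_trace, hR.eq]

theorem continuous_hsNormSq : Continuous (hsNormSq : Matrix m n ℂ → ℝ) := by
  unfold hsNormSq
  fun_prop

variable [DecidableEq n]

theorem hsNormSq_unitary_mul (V : Matrix.unitaryGroup n ℂ) (M : Matrix n m ℂ) :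
    hsNormSq ((V : Matrix n n ℂ) * M) = hsNormSq M := by
  rw [hsNormSq_eq_re_trace, hsNormSq_eq_re_trace, Matrix.conjTranspose_mul, Matrix.mul_assoc,
    ← Matrix.mul_assoc _ (V : Matrix n n ℂ) M, ← Matrix.star_eq_conjTranspose (V : Matrix n n ℂ),
    Unitary.coe_star_mul_self, Matrix.one_mul]

theorem hsNormSq_mul_unitary (V : Matrix.unitaryGroup n ℂ) (M : Matrix m n ℂ) :
    hsNormSq (M * (V : Matrix n n ℂ)) = hsNormSq M := by
  rw [← hsNormSq_conjTranspose, Matrix.conjTranspose_mul, ← Matrix.star_eq_conjTranspose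
    (V : Matrix n n ℂ), ← Unitary.coe_star, hsNormSq_unitary_mul, hsNormSq_conjTranspose]

theorem traceNorm_eq (M : Matrix n n ℂ) : traceNorm M = (CFC.abs M).trace.re := rfl

theorem traceNorm_of_posSemidef {M : Matrix n n ℂ} (hM : M.PosSemidef) :
    traceNorm M = M.trace.re := by
  rw [traceNorm_eq, CFC.abs_of_nonneg M (Matrix.nonneg_iff_posSemidef.2 hM)]

theorem traceNorm_neg (M : Matrix n n ℂ) : traceNorm (-M) = traceNorm M := by
  rw [traceNorm_eq, CFC.abs_neg, traceNorm_eq]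

/-- A matrix whose Gram matrix is diagonal is a unitary times a nonnegative diagonal matrix. -/
theorem exists_unitary_mul_diagonal {N : Matrix n n ℂ} {d : n → ℝ} (hd : ∀ i, 0 ≤ d i)
    (h : Nᴴ * N = Matrix.diagonal fun i => ((d i : ℂ) ^ 2)) :
    ∃ V : Matrix.unitaryGroup n ℂ, N = (V : Matrix n n ℂ) * Matrix.diagonal fun i => (d i : ℂ) := by
  let f : n → EuclideanSpace ℂ n := fun j => WithLp.toLp 2 (N.col j)
  have hf : ∀ i j, inner ℂ (f i) (f j) = if i = j then (d i : ℂ) ^ 2 else 0 := by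
    intro i j
    have := congrFun (congrFun h i) j
    rw [Matrix.diagonal_apply] at this
    rw [← this, Matrix.mul_apply, PiLp.inner_apply]
    refine Finset.sum_congr rfl fun k _ => ?_
    simp [f, Matrix.conjTranspose_apply, mul_comm]
  have horth : ∀ i j, i ≠ j → inner ℂ (f i) (f j) = 0 := fun i j hij => by
    rw [hf, if_neg hij]
  have hnorm : ∀ i, ‖f i‖ = d i := by
    intro i
    have h1 := inner_self_eq_norm_sq_to_K (𝕜 := ℂ) (f i)
    rw [hf, if_pos rfl] at h1
    have h2 : d i ^ 2 = ‖f i‖ ^ 2 := Complex.ofReal_injective (by push_cast; exact h1)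
    exact ((sq_eq_sq₀ (hd i) (norm_nonneg _)).1 h2).symm
  have hcard : Module.finrank ℂ (EuclideanSpace ℂ n) = Fintype.card n := by simp
  obtain ⟨b, hb⟩ : ∃ b : OrthonormalBasis n ℂ (EuclideanSpace ℂ n),
      ∀ i, f i = (d i : ℂ) • b i := by
    -- The nonzero columns are orthogonal and are normalized. The extension to a basis chooses the
    -- remaining vectors freely, which is harmless since they are multiplied by `d i = 0`.
    have hon : Orthonormal ℂ ({i | d i ≠ 0}.domRestrict fun i => ((d i : ℂ)⁻¹) • f i) := by
      constructor
      · rintro ⟨i, hi⟩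
        simp only [Set.domRestrict_apply, norm_smul, hnorm, norm_inv, Complex.norm_real,
          Real.norm_eq_abs, abs_of_nonneg (hd i)]
        exact inv_mul_cancel₀ hi
      · rintro ⟨i, hi⟩ ⟨j, hj⟩ hij
        simp only [Set.domRestrict_apply, inner_smul_left, inner_smul_right]
        rw [horth _ _ (fun h => hij (Subtype.ext h))]
        simp
    obtain ⟨b, hb⟩ := hon.exists_orthonormalBasis_extension_of_card_eq hcard
    refine ⟨b, fun i => ?_⟩
    by_cases hi : d i = 0
    · rw [hi, Complex.ofReal_zero, zero_smul, ← norm_eq_zero, hnorm, hi]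
    · rw [hb i hi, smul_inv_smul₀ (Complex.ofReal_ne_zero.2 hi)]
  let V : Matrix n n ℂ := Matrix.of fun i j => b j i
  have hV : Vᴴ * V = 1 := by
    ext i j
    have := orthonormal_iff_ite.1 b.orthonormal i j
    rw [Matrix.one_apply, ← this, Matrix.mul_apply, PiLp.inner_apply]
    refine Finset.sum_congr rfl fun k _ => ?_
    simp [V, Matrix.conjTranspose_apply, mul_comm]
  refine ⟨⟨V, Matrix.mem_unitaryGroup_iff'.2 hV⟩, ?_⟩
  ext i j
  have := congrArg (fun v : EuclideanSpace ℂ n => v i) (hb j)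
  simp only [f, PiLp.smul_apply, smul_eq_mul, Matrix.col_apply] at this
  rw [Matrix.mul_diagonal, this]
  simp [V, mul_comm]

/-- Polar decomposition. -/
theorem exists_unitary_mul_abs (M : Matrix n n ℂ) :
    ∃ V : Matrix.unitaryGroup n ℂ, M = (V : Matrix n n ℂ) * CFC.abs M := by
  have hH : (Mᴴ * M).PosSemidef := Matrix.posSemidef_conjTranspose_mul_self M
  let W := hH.1.eigenvectorUnitary
  let d : n → ℝ := fun i => √(hH.1.eigenvalues i)
  have hspec := hH.1.conjStarAlgAut_star_eigenvectorUnitary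
  rw [Unitary.conjStarAlgAut_star_apply] at hspec
  -- In an eigenbasis of `Mᴴ * M` the columns of `M * W` are orthogonal, so no invertibility of `M`
  -- is needed.
  have hdiag : (M * (W : Matrix n n ℂ))ᴴ * (M * (W : Matrix n n ℂ)) =
      Matrix.diagonal fun i => ((d i : ℂ) ^ 2) := by
    rw [Matrix.conjTranspose_mul, Matrix.mul_assoc, ← Matrix.mul_assoc Mᴴ, ← Matrix.mul_assoc]
    refine hspec.trans ?_
    congr 1
    ext i
    simp only [d, Function.comp_apply]
    rw [← Complex.ofReal_pow, Real.sq_sqrt (hH.eigenvalues_nonneg i)]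
    rfl
  obtain ⟨V, hV⟩ := exists_unitary_mul_diagonal (fun i => Real.sqrt_nonneg _) hdiag
  set D : Matrix n n ℂ := Matrix.diagonal fun i => (d i : ℂ) with hD
  have hDpos : D.PosSemidef := Matrix.PosSemidef.diagonal fun i => 
    Complex.zero_le_real.2 (Real.sqrt_nonneg _)
  have hWW : star (W : Matrix n n ℂ) * (W : Matrix n n ℂ) = 1 := Unitary.coe_star_mul_self W
  have hWW' : (W : Matrix n n ℂ) * star (W : Matrix n n ℂ) = 1 := Unitary.coe_mul_star_self W
  have hP : ((W : Matrix n n ℂ) * D * star (W : Matrix n n ℂ)).PosSemidef :=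
    hDpos.mul_mul_conjTranspose_same _
  have hM : M = (V : Matrix n n ℂ) * D * star (W : Matrix n n ℂ) := by
    rw [← hV, Matrix.mul_assoc, hWW', Matrix.mul_one]
  have habs : CFC.abs M = (W : Matrix n n ℂ) * D * star (W : Matrix n n ℂ) := by
    refine CFC.sqrt_unique ?_ (Matrix.nonneg_iff_posSemidef.2 hP)
    have hVV : star (V : Matrix n n ℂ) * (V : Matrix n n ℂ) = 1 := Unitary.coe_star_mul_self V
    have hDs : star D = D := hDpos.1
    conv_rhs => rw [hM]
    simp only [star_mul, star_star, hDs]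
    calc _ = (W : Matrix n n ℂ) * D * (star (W : Matrix n n ℂ) * W) * D * star (W : Matrix n n ℂ) := by
          noncomm_ring
      _ = (W : Matrix n n ℂ) * D * (star (V : Matrix n n ℂ) * V) * D * star (W : Matrix n n ℂ) := by
          rw [hWW, hVV]
      _ = _ := by noncomm_ring
  refine ⟨V * star W, ?_⟩
  rw [habs]
  conv_lhs => rw [hM]
  rw [Submonoid.coe_mul, Unitary.coe_star]
  calc _ = (V : Matrix n n ℂ) * 1 * D * star (W : Matrix n n ℂ) := by rw [Matrix.mul_one]
    _ = _ := by rw [← hWW]; noncomm_ring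

theorem posSemidef_abs (M : Matrix n n ℂ) : (CFC.abs M).PosSemidef :=
  Matrix.nonneg_iff_posSemidef.1 (CFC.abs_nonneg M)

/-- A positive semidefinite matrix is the square of a positive semidefinite matrix. -/
theorem exists_posSemidef_sq {P : Matrix n n ℂ} (hP : P.PosSemidef) :
    ∃ R : Matrix n n ℂ, R.PosSemidef ∧ R * R = P :=
  ⟨CFC.sqrt P, Matrix.nonneg_iff_posSemidef.1 (CFC.sqrt_nonneg P),
    CFC.sqrt_mul_sqrt_self P (Matrix.nonneg_iff_posSemidef.2 hP)⟩

/-- With `P = R * R`, Cauchy-Schwarz applied to `(V R) R` gives `‖R‖₂² = tr P`. -/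
theorem norm_trace_unitary_mul_posSemidef_le (V : Matrix.unitaryGroup n ℂ) {P : Matrix n n ℂ}
    (hP : P.PosSemidef) : ‖((V : Matrix n n ℂ) * P).trace‖ ≤ P.trace.re := by
  obtain ⟨R, hR, rfl⟩ := exists_posSemidef_sq hP
  rw [← Matrix.mul_assoc]
  refine (norm_trace_mul_le _ _).trans ?_
  rw [hsNormSq_unitary_mul, Real.mul_self_sqrt (hsNormSq_nonneg _), hsNormSq_of_isHermitian hR.1]

theorem norm_trace_unitary_mul_le (V : Matrix.unitaryGroup n ℂ) (M : Matrix n n ℂ) :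
    ‖((V : Matrix n n ℂ) * M).trace‖ ≤ traceNorm M := by
  obtain ⟨W, hW⟩ := exists_unitary_mul_abs M
  have := norm_trace_unitary_mul_posSemidef_le (V * W) (posSemidef_abs M)
  rwa [Submonoid.coe_mul, Matrix.mul_assoc, ← hW] at this

theorem re_trace_unitary_mul_le (V : Matrix.unitaryGroup n ℂ) (M : Matrix n n ℂ) :
    ((V : Matrix n n ℂ) * M).trace.re ≤ traceNorm M :=
  (Complex.re_le_norm _).trans (norm_trace_unitary_mul_le V M)

/-- The inverse polar unitary attains the bound of `re_trace_unitary_mul_le`, so the trace norm is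
the maximum of `Re tr (V M)` over unitaries. The triangle inequality and the later trace norm
estimates rest on this variational formula. -/
theorem exists_unitary_trace_eq (M : Matrix n n ℂ) :
    ∃ V : Matrix.unitaryGroup n ℂ, ((V : Matrix n n ℂ) * M).trace.re = traceNorm M := by
  obtain ⟨W, hW⟩ := exists_unitary_mul_abs M
  refine ⟨star W, ?_⟩
  conv_lhs => rw [hW]
  rw [← Matrix.mul_assoc, Unitary.coe_star, Unitary.coe_star_mul_self, Matrix.one_mul, traceNorm_eq]

theorem traceNorm_nonneg (M : Matrix n n ℂ) : 0 ≤ traceNorm M :=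
  (norm_nonneg _).trans (norm_trace_unitary_mul_le 1 M)

theorem traceNorm_add_le (M N : Matrix n n ℂ) : traceNorm (M + N) ≤ traceNorm M + traceNorm N := by
  obtain ⟨V, hV⟩ := exists_unitary_trace_eq (M + N)
  rw [← hV, Matrix.mul_add, Matrix.trace_add, Complex.add_re]
  exact add_le_add (re_trace_unitary_mul_le V M) (re_trace_unitary_mul_le V N)

theorem traceNorm_sub_le (M N : Matrix n n ℂ) : traceNorm (M - N) ≤ traceNorm M + traceNorm N := by
  rw [sub_eq_add_neg, ← traceNorm_neg N]
  exact traceNorm_add_le _ _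

theorem traceNorm_mul_le (X Y : Matrix n n ℂ) :
    traceNorm (X * Y) ≤ √(hsNormSq X) * √(hsNormSq Y) := by
  obtain ⟨V, hV⟩ := exists_unitary_trace_eq (X * Y)
  rw [← hV, ← Matrix.mul_assoc]
  refine (Complex.re_le_norm _).trans ((norm_trace_mul_le _ _).trans ?_)
  rw [hsNormSq_unitary_mul]

theorem traceNorm_real_smul (c : ℝ) (hc : 0 ≤ c) (M : Matrix n n ℂ) :
    traceNorm (c • M) = c * traceNorm M := by
  have h : ∀ V : Matrix.unitaryGroup n ℂ, ((V : Matrix n n ℂ) * (c • M)).trace.re =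
      c * ((V : Matrix n n ℂ) * M).trace.re := fun V => by
    rw [Matrix.mul_smul, Matrix.trace_smul, Complex.smul_re, smul_eq_mul]
  apply le_antisymm
  · obtain ⟨V, hV⟩ := exists_unitary_trace_eq (c • M)
    rw [← hV, h]
    exact mul_le_mul_of_nonneg_left (re_trace_unitary_mul_le V M) hc
  · obtain ⟨V, hV⟩ := exists_unitary_trace_eq M
    rw [← hV, ← h]
    exact re_trace_unitary_mul_le V _

theorem traceNorm_conjTranspose (M : Matrix n n ℂ) : traceNorm Mᴴ = traceNorm M := by
  have key : ∀ N : Matrix n n ℂ, traceNorm Nᴴ ≤ traceNorm N := fun N => by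
    obtain ⟨V, hV⟩ := exists_unitary_trace_eq Nᴴ
    rw [← hV]
    refine le_trans (le_of_eq ?_) (re_trace_unitary_mul_le (star V) N)
    rw [Unitary.coe_star, Matrix.star_eq_conjTranspose, Matrix.trace_mul_comm,
      ← re_trace_conjTranspose, Matrix.conjTranspose_mul, Matrix.conjTranspose_conjTranspose]
  refine le_antisymm (key M) ?_
  simpa using key Mᴴ

/-- A Hermitian matrix is a difference of positive semidefinite matrices whose traces add up to its
trace norm. -/
theorem exists_posSemidef_sub_posSemidef {M : Matrix n n ℂ} (hM : M.IsHermitian) :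
    ∃ P N : Matrix n n ℂ, P.PosSemidef ∧ N.PosSemidef ∧ M = P - N ∧
      P.trace.re + N.trace.re = traceNorm M := by
  have hsa : IsSelfAdjoint M := hM
  refine ⟨M⁺, M⁻, Matrix.nonneg_iff_posSemidef.1 (CFC.posPart_nonneg M),
    Matrix.nonneg_iff_posSemidef.1 (CFC.negPart_nonneg M), (CFC.posPart_sub_negPart M hsa).symm, ?_⟩
  rw [traceNorm_eq, ← CFC.posPart_add_negPart M hsa, Matrix.trace_add, Complex.add_re]

theorem traceNorm_le_sqrt_card_mul (M : Matrix n n ℂ) :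
    traceNorm M ≤ √(Fintype.card n) * √(hsNormSq M) := by
  have h : hsNormSq (1 : Matrix n n ℂ) = Fintype.card n := by
    rw [hsNormSq_eq_re_trace]; simp
  simpa [h] using traceNorm_mul_le 1 M

/-- The triangle inequality and `‖·‖₁ ≤ √n ‖·‖₂` make the trace norm Lipschitz for the
Hilbert-Schmidt norm. -/
theorem continuous_traceNorm : Continuous (traceNorm : Matrix n n ℂ → ℝ) := by
  rw [continuous_iff_continuousAt]
  intro M
  have hlim : Filter.Tendsto (fun N : Matrix n n ℂ => √(Fintype.card n) * √(hsNormSq (N - M)))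
      (nhds M) (nhds 0) := by
    have : Continuous fun N : Matrix n n ℂ => √(Fintype.card n) * √(hsNormSq (N - M)) :=
      continuous_const.mul (Real.continuous_sqrt.comp
        (continuous_hsNormSq.comp (continuous_id.sub continuous_const)))
    simpa [hsNormSq] using this.tendsto M
  refine tendsto_iff_norm_sub_tendsto_zero.2
    (squeeze_zero (fun _ => norm_nonneg _) (fun N => ?_) hlim)
  refine le_trans ?_ (traceNorm_le_sqrt_card_mul _)
  have h1 := traceNorm_add_le (N - M) M
  have h2 := traceNorm_add_le (-(N - M)) N
  rw [traceNorm_neg] at h2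
  simp only [sub_add_cancel, neg_sub] at h1 h2
  rw [Real.norm_eq_abs, abs_le]
  constructor <;> linarith

end TraceNorm

/-! ### Fidelity, purified distance and trace distance -/

section Fidelity

variable {n : Type*} [Fintype n]

theorem hsNormSq_add (X Y : Matrix n n ℂ) :
    hsNormSq (X + Y) = hsNormSq X + hsNormSq Y + 2 * (Xᴴ * Y).trace.re := by
  have h : (Yᴴ * X).trace.re = (Xᴴ * Y).trace.re := by
    rw [← re_trace_conjTranspose, Matrix.conjTranspose_mul, Matrix.conjTranspose_conjTranspose]
  simp only [hsNormSq_eq_re_trace, Matrix.conjTranspose_add, Matrix.add_mul, Matrix.mul_add,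
    Matrix.trace_add, Complex.add_re, h]
  ring

theorem hsNormSq_sub (X Y : Matrix n n ℂ) :
    hsNormSq (X - Y) = hsNormSq X + hsNormSq Y - 2 * (Xᴴ * Y).trace.re := by
  have hn : hsNormSq (-Y) = hsNormSq Y := by simp [hsNormSq]
  rw [sub_eq_add_neg, hsNormSq_add, hn]
  simp
  ring

variable [DecidableEq n]

theorem fidelity_nonneg (ρ σ : Matrix n n ℂ) : 0 ≤ fidelity ρ σ := traceNorm_nonneg _

/-- A Fuchs-van de Graaf inequality for unnormalized operators. With `R = √ρ` and `C = √σ V`, where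
`V` attains the fidelity, `‖R ∓ C‖₂² = tr ρ + tr σ ∓ 2F`, and `ρ - σ` is the Hermitian part of `(R -
C)(R + C)†`. -/
theorem fidelity_sq_le_and_traceNorm_sub_sq_le {ρ σ : Matrix n n ℂ} (hρ : ρ.PosSemidef)
    (hσ : σ.PosSemidef) :
    fidelity ρ σ ^ 2 ≤ ρ.trace.re * σ.trace.re ∧
      traceNorm (ρ - σ) ^ 2 ≤ (ρ.trace.re + σ.trace.re) ^ 2 - 4 * fidelity ρ σ ^ 2 := by
  have hR : (CFC.sqrt ρ).PosSemidef := Matrix.nonneg_iff_posSemidef.1 (CFC.sqrt_nonneg ρ)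
  have hS : (CFC.sqrt σ).PosSemidef := Matrix.nonneg_iff_posSemidef.1 (CFC.sqrt_nonneg σ)
  have hRR : CFC.sqrt ρ * CFC.sqrt ρ = ρ :=
    CFC.sqrt_mul_sqrt_self ρ (Matrix.nonneg_iff_posSemidef.2 hρ)
  have hSS : CFC.sqrt σ * CFC.sqrt σ = σ :=
    CFC.sqrt_mul_sqrt_self σ (Matrix.nonneg_iff_posSemidef.2 hσ)
  set R := CFC.sqrt ρ
  set S := CFC.sqrt σ
  obtain ⟨V, hV⟩ := exists_unitary_trace_eq (R * S)
  have hr : hsNormSq R = ρ.trace.re := by rw [hsNormSq_of_isHermitian hR.1, hRR]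
  have hs : hsNormSq S = σ.trace.re := by rw [hsNormSq_of_isHermitian hS.1, hSS]
  have hf : (R * (S * (V : Matrix n n ℂ))).trace.re = fidelity ρ σ := by
    rw [← Matrix.mul_assoc, Matrix.trace_mul_comm, hV]
    rfl
  have hr0 := hsNormSq_nonneg R
  have hs0 := hsNormSq_nonneg S
  have hf0 := fidelity_nonneg ρ σ
  constructor
  · have h := traceNorm_mul_le R S
    have h2 := pow_le_pow_left₀ (traceNorm_nonneg _) h 2
    rw [mul_pow, Real.sq_sqrt hr0, Real.sq_sqrt hs0, hr, hs] at h2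
    exact h2
  · set C := S * (V : Matrix n n ℂ) with hC
    have hc : hsNormSq C = σ.trace.re := by rw [hC, hsNormSq_mul_unitary, hs]
    have hCC : C * Cᴴ = σ := by
      rw [hC, Matrix.conjTranspose_mul, hS.1.eq, Matrix.mul_assoc, ← Matrix.mul_assoc _ _ S,
        ← Matrix.star_eq_conjTranspose, Unitary.mul_star_self_of_mem V.2, Matrix.one_mul, hSS]
    have hsub : hsNormSq (R - C) = ρ.trace.re + σ.trace.re - 2 * fidelity ρ σ := by
      rw [hsNormSq_sub, hR.1.eq, hf, hr, hc]
    have hadd : hsNormSq (R + C) = ρ.trace.re + σ.trace.re + 2 * fidelity ρ σ := by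
      rw [hsNormSq_add, hR.1.eq, hf, hr, hc]
    have hid : ρ - σ = ((1 / 2 : ℝ)) • ((R - C) * (R + C)ᴴ + ((R - C) * (R + C)ᴴ)ᴴ) := by
      have : (R - C) * (R + C)ᴴ + ((R - C) * (R + C)ᴴ)ᴴ = (2 : ℝ) • (ρ - σ) := by
        rw [two_smul, ← hRR, ← hCC]
        simp only [Matrix.conjTranspose_mul, Matrix.conjTranspose_add, Matrix.conjTranspose_sub,
          hR.1.eq, Matrix.conjTranspose_conjTranspose]
        noncomm_ring
      rw [this, smul_smul]
      norm_num
    have hle : traceNorm (ρ - σ) ≤ √(hsNormSq (R - C)) * √(hsNormSq (R + C)) := by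
      rw [hid, traceNorm_real_smul _ (by norm_num)]
      have h1 := traceNorm_add_le ((R - C) * (R + C)ᴴ) ((R - C) * (R + C)ᴴ)ᴴ
      rw [traceNorm_conjTranspose] at h1
      have h2 := traceNorm_mul_le (R - C) (R + C)ᴴ
      rw [hsNormSq_conjTranspose] at h2
      linarith
    have h2 := pow_le_pow_left₀ (traceNorm_nonneg _) hle 2
    rw [mul_pow, Real.sq_sqrt (hsNormSq_nonneg _), Real.sq_sqrt (hsNormSq_nonneg _), hsub,
      hadd] at h2
    linarith

/-- The trace distance is bounded by the purified distance. -/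
theorem traceNorm_sub_le_two_mul {ρ σ : Matrix n n ℂ} (hρ : IsSubnormalized ρ)
    (hσ : IsSubnormalized σ) {ε : ℝ} (hε : 0 ≤ ε) (h : purifiedDist ρ σ ≤ ε) :
    traceNorm (ρ - σ) ≤ 2 * ε := by
  obtain ⟨h1, h2⟩ := fidelity_sq_le_and_traceNorm_sub_sq_le hρ.1 hσ.1
  have hr := trace_re_nonneg hρ.1
  have hs := trace_re_nonneg hσ.1
  have hr1 := hρ.2
  have hs1 := hσ.2
  have hf0 := fidelity_nonneg ρ σ
  have h3 : 1 - genFidelity ρ σ ^ 2 ≤ ε ^ 2 := (Real.sqrt_le_left hε).1 h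
  rw [genFidelity] at h3
  set F := fidelity ρ σ
  set r := ρ.trace.re
  set s := σ.trace.re
  set g := √((1 - r) * (1 - s)) with hg
  have hg0 : 0 ≤ g := Real.sqrt_nonneg _
  have hgg : g ^ 2 = (1 - r) * (1 - s) :=
    Real.sq_sqrt (mul_nonneg (by linarith) (by linarith))
  -- From `F² ≤ r s` and the inequality between arithmetic and geometric means for `r (1 - r)` and
  -- `s (1 - s)`. With it the claim reduces to `0 ≤ 3 (r - s)²`.
  have hFg : 2 * (F * g) ≤ r * (1 - r) + s * (1 - s) := by
    have hx : 0 ≤ r * (1 - r) := mul_nonneg hr (by linarith)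
    have hy : 0 ≤ s * (1 - s) := mul_nonneg hs (by linarith)
    refine abs_le_of_sq_le_sq' ?_ (by linarith) |>.2
    have : (F * g) ^ 2 ≤ (r * (1 - r)) * (s * (1 - s)) := by
      rw [mul_pow, hgg]
      calc F ^ 2 * ((1 - r) * (1 - s)) ≤ (r * s) * ((1 - r) * (1 - s)) :=
            mul_le_mul_of_nonneg_right h1 (mul_nonneg (by linarith) (by linarith))
        _ = _ := by ring
    nlinarith [sq_nonneg (r * (1 - r) - s * (1 - s))]
  refine abs_le_of_sq_le_sq' ?_ (by linarith) |>.2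
  nlinarith [sq_nonneg (r - s)]

end Fidelity

/-! ### Unitarily invariant bilinear forms -/

section InvariantForms

theorem exists_perm_apply_eq_apply_eq {A : Type*} [DecidableEq A] {i j k l : A} (hij : i ≠ j) (hkl : k ≠ l) :
    ∃ s : Equiv.Perm A, s i = k ∧ s j = l := by
  refine ⟨Equiv.swap (Equiv.swap i k j) l * Equiv.swap i k, ?_, ?_⟩
  · rw [Equiv.Perm.mul_apply, Equiv.swap_apply_left, Equiv.swap_apply_of_ne_of_ne _ hkl]
    intro h
    have := congrArg (Equiv.swap i k) h
    rw [Equiv.swap_apply_self, Equiv.swap_apply_right] at this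
    exact hij this
  · rw [Equiv.Perm.mul_apply, Equiv.swap_apply_left]

variable {A : Type*} [Fintype A] [DecidableEq A]

/-- Conjugation by a unitary. -/
def conjUnitary (U : Matrix.unitaryGroup A ℂ) (X : Matrix A A ℂ) : Matrix A A ℂ :=
  (U : Matrix A A ℂ) * X * (U : Matrix A A ℂ)ᴴ

theorem conjUnitary_mul (U V : Matrix.unitaryGroup A ℂ) (X : Matrix A A ℂ) :
    conjUnitary (U * V) X = conjUnitary U (conjUnitary V X) := by
  simp only [conjUnitary, Submonoid.coe_mul, Matrix.conjTranspose_mul, Matrix.mul_assoc]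

theorem conjUnitary_add (U : Matrix.unitaryGroup A ℂ) (X Y : Matrix A A ℂ) :
    conjUnitary U (X + Y) = conjUnitary U X + conjUnitary U Y := by
  simp only [conjUnitary, Matrix.mul_add, Matrix.add_mul]

theorem conjUnitary_smul (U : Matrix.unitaryGroup A ℂ) (c : ℂ) (X : Matrix A A ℂ) :
    conjUnitary U (c • X) = c • conjUnitary U X := by
  simp only [conjUnitary, Matrix.mul_smul, Matrix.smul_mul]

theorem coe_mul_conjTranspose (U : Matrix.unitaryGroup A ℂ) :
    (U : Matrix A A ℂ) * (U : Matrix A A ℂ)ᴴ = 1 := Unitary.mul_star_self_of_mem U.2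

theorem conjTranspose_mul_coe (U : Matrix.unitaryGroup A ℂ) :
    (U : Matrix A A ℂ)ᴴ * (U : Matrix A A ℂ) = 1 := Unitary.star_mul_self_of_mem U.2

theorem conjUnitary_one (U : Matrix.unitaryGroup A ℂ) : conjUnitary U (1 : Matrix A A ℂ) = 1 := by
  rw [conjUnitary, Matrix.mul_one, coe_mul_conjTranspose]

theorem continuous_conjUnitary (X : Matrix A A ℂ) :
    Continuous fun U : Matrix.unitaryGroup A ℂ => conjUnitary U X := by
  unfold conjUnitary
  exact (continuous_subtype_val.matrix_mul continuous_const).matrix_mul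
    continuous_subtype_val.matrix_conjTranspose

/-- The matrix units. -/
abbrev matrixUnit (i j : A) : Matrix A A ℂ := Matrix.single i j 1

theorem eq_sum_smul_matrixUnit (X : Matrix A A ℂ) : X = ∑ i, ∑ j, X i j • matrixUnit i j := by
  conv_lhs => rw [Matrix.matrix_eq_sum_single X]
  simp [Matrix.smul_single]

/-- A diagonal unitary. -/
theorem exists_diagonal_unitary (z : A → ℂ) (hz : ∀ i, z i * star (z i) = 1) :
    ∃ U : Matrix.unitaryGroup A ℂ, ∀ i j, conjUnitary U (matrixUnit i j) =
      (z i * star (z j)) • matrixUnit i j := by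
  refine ⟨⟨Matrix.diagonal z, Matrix.mem_unitaryGroup_iff.2 ?_⟩, fun i j => ?_⟩
  · rw [Matrix.star_eq_conjTranspose, Matrix.diagonal_conjTranspose, Matrix.diagonal_mul_diagonal]
    simp only [Pi.star_apply, hz, Matrix.diagonal_one]
  · ext k l
    simp only [conjUnitary, Matrix.diagonal_conjTranspose, Matrix.mul_diagonal,
      Matrix.diagonal_mul, Matrix.smul_apply, Matrix.single_apply, smul_eq_mul]
    split_ifs with h
    · obtain ⟨rfl, rfl⟩ := h
      simp
    · simp

theorem exists_permutation_unitary (s : Equiv.Perm A) :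
    ∃ U : Matrix.unitaryGroup A ℂ, ∀ i j, conjUnitary U (matrixUnit i j) =
      matrixUnit (s i) (s j) := by
  refine ⟨⟨(1 : Matrix A A ℂ).submatrix s.symm id, Matrix.mem_unitaryGroup_iff.2 ?_⟩,
    fun i j => ?_⟩
  · ext i j
    simp [Matrix.mul_apply, Matrix.star_eq_conjTranspose, Matrix.one_apply]
  · ext k l
    simp only [conjUnitary, Matrix.mul_apply, Matrix.submatrix_apply, id_eq,
      Matrix.conjTranspose_apply, Matrix.one_apply, Matrix.single_apply, Finset.sum_ite_eq,
      Finset.mem_univ, if_true, apply_ite star, star_one, star_zero, mul_ite, mul_one, mul_zero]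
    simp only [ite_and, Equiv.symm_apply_eq, Finset.sum_ite_eq, Finset.mem_univ]
    split_ifs <;> simp_all [Equiv.eq_symm_apply]

theorem exists_hadamard_unitary {i j : A} (hij : i ≠ j) :
    ∃ U : Matrix.unitaryGroup A ℂ, conjUnitary U (matrixUnit i i) = (1 / 2 : ℂ) •
      (matrixUnit i i + matrixUnit i j + matrixUnit j i + matrixUnit j j) := by
  let r : ℂ := ((√2)⁻¹ : ℝ)
  have hr : r * r = 1 / 2 := by
    simp only [r]
    rw [← Complex.ofReal_mul, ← mul_inv, Real.mul_self_sqrt (by norm_num)]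
    norm_num
  have hrs : star r = r := Complex.conj_ofReal _
  let S : Matrix A A ℂ := matrixUnit i i + matrixUnit j j
  let K : Matrix A A ℂ := r • (matrixUnit i i + matrixUnit i j + matrixUnit j i - matrixUnit j j)
  have hK : Kᴴ = K := by
    simp only [K, Matrix.conjTranspose_smul, Matrix.conjTranspose_sub, Matrix.conjTranspose_add,
      Matrix.conjTranspose_single, star_one, hrs]
    congr 2
    exact add_right_comm _ _ _
  have hS : Sᴴ = S := by
    simp [S, Matrix.conjTranspose_add, Matrix.conjTranspose_single]
  have hSS : S * S = S := by
    simp [S, Matrix.mul_add, Matrix.add_mul, hij, hij.symm]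
  have hSK : S * K = K := by
    simp [S, K, Matrix.mul_add, Matrix.mul_sub, Matrix.add_mul, hij, hij.symm]
  have hKS : K * S = K := by
    have := congrArg Matrix.conjTranspose hSK
    rwa [Matrix.conjTranspose_mul, hK, hS] at this
  have hKK : K * K = S := by
    simp only [K, Matrix.smul_mul, Matrix.mul_smul, smul_smul, hr]
    simp [S, Matrix.mul_add, Matrix.mul_sub, Matrix.add_mul, Matrix.sub_mul, hij, hij.symm]
    module
  -- `S` projects onto the span of the basis vectors `i` and `j`; `K` is the Hadamard matrix there,
  -- and `H` is the identity on the complement.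
  let H : Matrix A A ℂ := 1 - S + K
  have hH : Hᴴ = H := by simp [H, hK, hS]
  have hHH : H * H = 1 := by
    have : H * H = 1 - S - (S - S * S) + (K - S * K) + (K - K * S) + K * K := by
      simp only [H]; noncomm_ring
    rw [this, hSS, hSK, hKS, hKK]
    abel
  refine ⟨⟨H, Matrix.mem_unitaryGroup_iff.2 (by rw [Matrix.star_eq_conjTranspose, hH, hHH])⟩, ?_⟩
  have hHe : H * matrixUnit i i = r • (matrixUnit i i + matrixUnit j i) := by
    simp [H, S, K, Matrix.add_mul, Matrix.sub_mul, hij.symm]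
  have heH : matrixUnit i i * H = r • (matrixUnit i i + matrixUnit i j) := by
    have := congrArg Matrix.conjTranspose hHe
    rw [Matrix.conjTranspose_mul, hH] at this
    simpa [hrs] using this
  have : matrixUnit i i = matrixUnit i i * matrixUnit i i := by simp
  simp only [conjUnitary, hH]
  rw [this, ← Matrix.mul_assoc, Matrix.mul_assoc _ _ H, hHe, heH, Matrix.smul_mul, Matrix.mul_smul,
    smul_smul, hr]
  congr 1
  simp [Matrix.mul_add, Matrix.add_mul]
  abel

/-- A bilinear form on matrices that is invariant under conjugation by unitaries is a combination
of `tr (X Y)` and `tr X tr Y`. -/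
theorem exists_eq_of_invariant (Q : Matrix A A ℂ →ₗ[ℂ] Matrix A A ℂ →ₗ[ℂ] ℂ)
    (hQ : ∀ U X Y, Q (conjUnitary U X) (conjUnitary U Y) = Q X Y) :
    ∃ α γ : ℂ, ∀ X Y, Q X Y = α * (X * Y).trace + γ * (X.trace * Y.trace) := by
  suffices h : ∃ α γ : ℂ, ∀ i j k l, Q (matrixUnit i j) (matrixUnit k l) =
      α * (if i = l ∧ j = k then 1 else 0) + γ * (if i = j ∧ k = l then 1 else 0) by
    obtain ⟨α, γ, h⟩ := h
    refine ⟨α, γ, fun X Y => ?_⟩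
    conv_lhs => rw [eq_sum_smul_matrixUnit X, eq_sum_smul_matrixUnit Y]
    simp only [map_sum, map_smul, LinearMap.sum_apply, LinearMap.smul_apply, smul_eq_mul, h]
    have h1 : ∀ k l, (∑ i, ∑ j, X i j * (α * (if i = l ∧ j = k then 1 else 0) +
        γ * (if i = j ∧ k = l then 1 else 0))) =
        α * X l k + γ * (X.trace * if k = l then 1 else 0) := by
      intro k l
      simp only [mul_add, Finset.sum_add_distrib]
      congr 1
      · rw [Finset.sum_eq_single l, Finset.sum_eq_single k]
        · simp [mul_comm]
        · intro j _ hj; simp [hj]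
        · simp
        · intro i _ hi; simp [hi]
        · simp
      · simp only [Matrix.trace, Matrix.diag, Finset.sum_mul, Finset.mul_sum]
        refine Finset.sum_congr rfl fun i _ => ?_
        rw [Finset.sum_eq_single i]
        · simp only [true_and]; ring
        · intro j _ hj; simp [hj.symm]
        · simp
    simp only [h1]
    simp only [mul_add, Finset.sum_add_distrib]
    congr 1
    · simp only [Matrix.trace, Matrix.diag, Matrix.mul_apply, Finset.mul_sum]
      rw [Finset.sum_comm]
      exact Finset.sum_congr rfl fun i _ => Finset.sum_congr rfl fun j _ => by ring
    · simp only [mul_ite, mul_one, mul_zero, Finset.sum_ite_eq, Finset.mem_univ, if_true]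
      rw [← Finset.sum_mul, mul_comm]
      simp only [Matrix.trace, Matrix.diag]
      ring
  rcases subsingleton_or_nontrivial A with hA | hA
  · rcases isEmpty_or_nonempty A with hA' | ⟨⟨a⟩⟩
    · exact ⟨0, 0, fun i => isEmptyElim i⟩
    · refine ⟨Q (matrixUnit a a) (matrixUnit a a), 0, fun i j k l => ?_⟩
      rw [Subsingleton.elim i a, Subsingleton.elim j a, Subsingleton.elim k a,
        Subsingleton.elim l a]
      simp
  obtain ⟨a, b, hab⟩ := exists_pair_ne A
  have hperm : ∀ (s : Equiv.Perm A) i j k l, Q (matrixUnit (s i) (s j)) (matrixUnit (s k) (s l)) =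
      Q (matrixUnit i j) (matrixUnit k l) := by
    intro s i j k l
    obtain ⟨U, hU⟩ := exists_permutation_unitary s
    rw [← hU, ← hU, hQ]
  -- The phase `I` at the single index `p` forces `p` to occur equally often in `(i, k)` and `(j,
  -- l)`: the difference is divisible by 4 and at most 2 in size. A phase `-1` would not exclude a
  -- difference of 2.
  have hphase : ∀ p i j k l, Q (matrixUnit i j) (matrixUnit k l) ≠ 0 →
      (if i = p then Complex.I else 1) * (if j = p then -Complex.I else 1) *
        (if k = p then Complex.I else 1) * (if l = p then -Complex.I else 1) = 1 := by
    intro p i j k l hne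
    obtain ⟨U, hU⟩ := exists_diagonal_unitary (fun i : A => if i = p then Complex.I else 1)
      (fun i => by split_ifs <;> simp)
    have h := hQ U (matrixUnit i j) (matrixUnit k l)
    rw [hU, hU, map_smul, map_smul, LinearMap.smul_apply, smul_eq_mul, smul_eq_mul,
      ← mul_assoc, mul_eq_right₀ hne] at h
    refine Eq.trans ?_ h
    simp only [apply_ite star, Complex.star_def, Complex.conj_I, star_one]
    ring
  have hzero : ∀ i j k l, ¬ (i = l ∧ j = k) → ¬ (i = j ∧ k = l) →
      Q (matrixUnit i j) (matrixUnit k l) = 0 := by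
    intro i j k l h1 h2
    by_contra hne
    have hi := hphase i i j k l hne
    have hj := hphase j i j k l hne
    have hk := hphase k i j k l hne
    grind [Complex.I_mul_I, Complex.I_ne_zero]
  have hswap : Q (matrixUnit b b) (matrixUnit a a) = Q (matrixUnit a a) (matrixUnit b b) := by
    simpa using hperm (Equiv.swap a b) a a b b
  have hbb : Q (matrixUnit b b) (matrixUnit b b) = Q (matrixUnit a a) (matrixUnit a a) := by
    simpa using hperm (Equiv.swap a b) a a a a
  have hba : Q (matrixUnit b a) (matrixUnit a b) = Q (matrixUnit a b) (matrixUnit b a) := by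
    simpa using hperm (Equiv.swap a b) a b b a
  -- Phases and permutations leave three independent values; Hadamard invariance supplies the one
  -- relation between them.
  have hdiag : Q (matrixUnit a a) (matrixUnit a a) =
      Q (matrixUnit a b) (matrixUnit b a) + Q (matrixUnit a a) (matrixUnit b b) := by
    obtain ⟨U, hU⟩ := exists_hadamard_unitary hab
    have h := hQ U (matrixUnit a a) (matrixUnit a a)
    have hz : ∀ {i j k l}, ¬ (i = l ∧ j = k) → ¬ (i = j ∧ k = l) →
      Q (matrixUnit i j) (matrixUnit k l) = 0 := fun {i j k l} => hzero i j k l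
    rw [hU] at h
    simp only [map_smul, map_add, LinearMap.smul_apply, LinearMap.add_apply, smul_eq_mul] at h
    rw [hzero a a a b, hzero a a b a, hzero a b a a, hzero a b a b, hzero a b b b, hzero b a a a,
      hzero b a b a, hzero b a b b, hzero b b a b, hzero b b b a, hswap, hbb, hba] at h
    · linear_combination -2 * h
    all_goals simp [hab, hab.symm]
  refine ⟨Q (matrixUnit a b) (matrixUnit b a), Q (matrixUnit a a) (matrixUnit b b),
    fun i j k l => ?_⟩
  by_cases h1 : i = l ∧ j = k
  · obtain ⟨rfl, rfl⟩ := h1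
    by_cases h2 : i = j
    · subst h2
      have := hperm (Equiv.swap a i) a a a a
      rw [Equiv.swap_apply_left] at this
      rw [this, hdiag]
      simp
    · obtain ⟨s, rfl, rfl⟩ := exists_perm_apply_eq_apply_eq hab h2
      rw [hperm]
      simp [hab]
  · by_cases h2 : i = j ∧ k = l
    · obtain ⟨rfl, rfl⟩ := h2
      have hik : i ≠ k := fun h => h1 ⟨h, h⟩
      obtain ⟨s, rfl, rfl⟩ := exists_perm_apply_eq_apply_eq hab hik
      rw [hperm]
      simp [hab]
    · rw [hzero i j k l h1 h2, if_neg h1, if_neg h2]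
      simp

end InvariantForms

/-! ### Haar averages and their moments -/

section Twirl

variable {A : Type*} [Fintype A] [DecidableEq A]

instance : (haarUnitary A).IsHaarMeasure := by unfold haarUnitary; infer_instance

/-- A right translate of the measure is again a Haar probability measure, hence equal to it by
uniqueness. -/
instance : (haarUnitary A).IsMulRightInvariant where
  map_mul_right_eq_self g := by
    have : IsProbabilityMeasure ((haarUnitary A).map (· * g)) :=
      Measure.isProbabilityMeasure_map (continuous_mul_const g).aemeasurable
    exact Measure.isHaarMeasure_eq_of_isProbabilityMeasure _ _

theorem integrable_of_continuous {f : Matrix.unitaryGroup A ℂ → ℂ} (hf : Continuous f) :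
    Integrable f (haarUnitary A) :=
  hf.integrable_of_hasCompactSupport (HasCompactSupport.of_compactSpace f)

theorem continuous_bilin (G : Matrix A A ℂ →ₗ[ℂ] Matrix A A ℂ →ₗ[ℂ] ℂ) (X Y : Matrix A A ℂ) :
    Continuous fun U : Matrix.unitaryGroup A ℂ => G (conjUnitary U X) (conjUnitary U Y) := by
  let G' : Matrix A A ℂ →ₗ[ℂ] Matrix A A ℂ →L[ℂ] ℂ :=
    LinearMap.toContinuousLinearMap.toLinearMap ∘ₗ G
  exact (G'.continuous_of_finiteDimensional.comp (continuous_conjUnitary X)).clm_apply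
    (continuous_conjUnitary Y)

/-- The average of a bilinear form over conjugation by unitaries. -/
noncomputable def twirl (G : Matrix A A ℂ →ₗ[ℂ] Matrix A A ℂ →ₗ[ℂ] ℂ) :
    Matrix A A ℂ →ₗ[ℂ] Matrix A A ℂ →ₗ[ℂ] ℂ :=
  LinearMap.mk₂ ℂ (fun X Y => ∫ U, G (conjUnitary U X) (conjUnitary U Y) ∂haarUnitary A)
    (fun X X' Y => by
      simp only [conjUnitary_add, map_add, LinearMap.add_apply]
      exact integral_add (integrable_of_continuous (continuous_bilin G X Y))
        (integrable_of_continuous (continuous_bilin G X' Y)))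
    (fun c X Y => by
      simp only [conjUnitary_smul, map_smul, LinearMap.smul_apply]
      exact integral_smul _ _)
    (fun X Y Y' => by
      simp only [conjUnitary_add, map_add]
      exact integral_add (integrable_of_continuous (continuous_bilin G X Y))
        (integrable_of_continuous (continuous_bilin G X Y')))
    (fun c X Y => by
      simp only [conjUnitary_smul, map_smul]
      exact integral_smul _ _)

theorem twirl_apply (G : Matrix A A ℂ →ₗ[ℂ] Matrix A A ℂ →ₗ[ℂ] ℂ) (X Y : Matrix A A ℂ) :
    twirl G X Y = ∫ U, G (conjUnitary U X) (conjUnitary U Y) ∂haarUnitary A := rfl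

theorem twirl_conjUnitary (G : Matrix A A ℂ →ₗ[ℂ] Matrix A A ℂ →ₗ[ℂ] ℂ)
    (V : Matrix.unitaryGroup A ℂ) (X Y : Matrix A A ℂ) :
    twirl G (conjUnitary V X) (conjUnitary V Y) = twirl G X Y := by
  simp only [twirl_apply, ← conjUnitary_mul]
  exact integral_mul_right_eq_self (fun U => G (conjUnitary U X) (conjUnitary U Y)) V

theorem exists_twirl_eq (G : Matrix A A ℂ →ₗ[ℂ] Matrix A A ℂ →ₗ[ℂ] ℂ) :
    ∃ α γ : ℂ, ∀ X Y, twirl G X Y = α * (X * Y).trace + γ * (X.trace * Y.trace) :=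
  exists_eq_of_invariant _ (twirl_conjUnitary G)

/-- The contraction of a bilinear form against the swap operator. -/
def contraction (G : Matrix A A ℂ →ₗ[ℂ] Matrix A A ℂ →ₗ[ℂ] ℂ) : ℂ :=
  ∑ i, ∑ j, G (matrixUnit i j) (matrixUnit j i)

theorem mul_matrixUnit (X : Matrix A A ℂ) (i j : A) :
    X * matrixUnit i j = ∑ k, X k i • matrixUnit k j := by
  ext a b
  simp [Matrix.sum_apply, Matrix.single_apply, Matrix.mul_apply, ite_and]

theorem matrixUnit_mul (X : Matrix A A ℂ) (i j : A) :
    matrixUnit i j * X = ∑ k, X j k • matrixUnit i k := by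
  ext a b
  simp [Matrix.sum_apply, Matrix.single_apply, Matrix.mul_apply, ite_and]

/-- The swap operator `F = ∑ e_ij ⊗ e_ji` satisfies `(X ⊗ 1) F = F (1 ⊗ X)`. -/
theorem contraction_mul_left (G : Matrix A A ℂ →ₗ[ℂ] Matrix A A ℂ →ₗ[ℂ] ℂ) (X : Matrix A A ℂ) :
    ∑ i, ∑ j, G (X * matrixUnit i j) (matrixUnit j i) =
      ∑ i, ∑ j, G (matrixUnit i j) (matrixUnit j i * X) := by
  simp only [mul_matrixUnit, matrixUnit_mul, map_sum, map_smul, LinearMap.sum_apply,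
    LinearMap.smul_apply]
  rw [Finset.sum_comm]
  conv_rhs => rw [Finset.sum_comm]
  refine Finset.sum_congr rfl fun j _ => ?_
  rw [Finset.sum_comm]

theorem contraction_mul_right (G : Matrix A A ℂ →ₗ[ℂ] Matrix A A ℂ →ₗ[ℂ] ℂ) (X : Matrix A A ℂ) :
    ∑ i, ∑ j, G (matrixUnit i j * X) (matrixUnit j i) =
      ∑ i, ∑ j, G (matrixUnit i j) (X * matrixUnit j i) := by
  simp only [mul_matrixUnit, matrixUnit_mul, map_sum, map_smul, LinearMap.sum_apply,
    LinearMap.smul_apply]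
  refine Finset.sum_congr rfl fun j _ => ?_
  rw [Finset.sum_comm]

/-- `U ⊗ U` commutes with the swap operator: both factors `U` and `U†` are carried to the second
slot, where they cancel. -/
theorem contraction_conjUnitary (G : Matrix A A ℂ →ₗ[ℂ] Matrix A A ℂ →ₗ[ℂ] ℂ)
    (U : Matrix.unitaryGroup A ℂ) :
    ∑ i, ∑ j, G (conjUnitary U (matrixUnit i j)) (conjUnitary U (matrixUnit j i)) =
      contraction G := by
  have h1 := contraction_mul_left (G.compl₁₂ (LinearMap.mulRight ℂ (U : Matrix A A ℂ)ᴴ)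
    (LinearMap.mulLeft ℂ (U : Matrix A A ℂ) ∘ₗ LinearMap.mulRight ℂ (U : Matrix A A ℂ)ᴴ))
    (U : Matrix A A ℂ)
  have h2 := contraction_mul_right (G.compl₁₂ LinearMap.id
    (LinearMap.mulLeft ℂ (U : Matrix A A ℂ))) (U : Matrix A A ℂ)ᴴ
  simp only [LinearMap.compl₁₂_apply, LinearMap.comp_apply, LinearMap.mulLeft_apply,
    LinearMap.mulRight_apply, Matrix.mul_assoc, coe_mul_conjTranspose, Matrix.mul_one,
    LinearMap.id_apply] at h1 h2
  simp only [conjUnitary, Matrix.mul_assoc, contraction]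
  rw [h1, h2]
  simp only [← Matrix.mul_assoc, coe_mul_conjTranspose, Matrix.one_mul]

theorem contraction_twirl (G : Matrix A A ℂ →ₗ[ℂ] Matrix A A ℂ →ₗ[ℂ] ℂ) :
    contraction (twirl G) = contraction G := by
  have h : ∀ i j, Integrable (fun U => G (conjUnitary U (matrixUnit i j))
      (conjUnitary U (matrixUnit j i))) (haarUnitary A) :=
    fun i j => integrable_of_continuous (continuous_bilin G _ _)
  conv_lhs => rw [contraction]
  simp only [twirl_apply]
  simp_rw [← integral_finsetSum Finset.univ fun j _ => h _ j]
  rw [← integral_finsetSum Finset.univ fun i _ => integrable_finsetSum _ fun j _ => h i j]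
  simp only [contraction_conjUnitary]
  simp

/-- The second moment of the Haar measure on traceless matrices. -/
theorem exists_second_moment (G : Matrix A A ℂ →ₗ[ℂ] Matrix A A ℂ →ₗ[ℂ] ℂ) :
    ∃ α : ℂ, (∀ X Y : Matrix A A ℂ, X.trace = 0 →
        ∫ U, G (conjUnitary U X) (conjUnitary U Y) ∂haarUnitary A = α * (X * Y).trace) ∧
      α * ((Fintype.card A : ℂ) ^ 3 - Fintype.card A) =
        Fintype.card A * contraction G - G 1 1 := by
  -- Evaluation at `(1, 1)` and against the swap gives two linear equations for `α` and `γ`;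
  -- eliminating `γ` leaves the factor `n³ - n`, which is not divided out because it vanishes for `n
  -- = 1`.
  obtain ⟨α, γ, h⟩ := exists_twirl_eq G
  refine ⟨α, fun X Y hX => by rw [← twirl_apply, h, hX]; simp, ?_⟩
  have h1 : G 1 1 = α * Fintype.card A + γ * (Fintype.card A) ^ 2 := by
    have h2 := h 1 1
    rw [twirl_apply] at h2
    simp only [conjUnitary_one, integral_const, probReal_univ, one_smul, Matrix.mul_one,
      Matrix.trace_one] at h2
    rw [h2, sq]
  have h2 : contraction G = α * (Fintype.card A) ^ 2 + γ * Fintype.card A := by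
    rw [← contraction_twirl, contraction]
    simp only [h, Matrix.single_mul_single_same, mul_one, Matrix.trace_single_eq_same]
    have : ∀ i j : A, γ * ((matrixUnit i j).trace * (matrixUnit j i).trace) =
        if i = j then γ else 0 := by
      intro i j
      split_ifs with hij
      · subst hij; simp
      · simp [Matrix.trace_single_eq_of_ne _ _ _ hij]
    simp only [Finset.sum_add_distrib, this]
    simp
    ring
  rw [h1, h2]
  ring

/-- The first moment of the Haar measure. -/
theorem integral_conjUnitary [Nonempty A] (f : Matrix A A ℂ →ₗ[ℂ] ℂ) (X : Matrix A A ℂ) :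
    ∫ U, f (conjUnitary U X) ∂haarUnitary A = X.trace / Fintype.card A * f 1 := by
  -- The form is `(Z, Y) ↦ tr Z · f Y`, used below at `Z = 1`.
  obtain ⟨α, γ, h⟩ := exists_twirl_eq
    ((LinearMap.lsmul ℂ (Matrix A A ℂ →ₗ[ℂ] ℂ)).flip f ∘ₗ Matrix.traceLinearMap A ℂ ℂ)
  have hn : (Fintype.card A : ℂ) ≠ 0 := Nat.cast_ne_zero.2 Fintype.card_ne_zero
  have h1 : ∀ Y : Matrix A A ℂ, ∫ U, f (conjUnitary U Y) ∂haarUnitary A =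
      (α / Fintype.card A + γ) * Y.trace := by
    intro Y
    have h2 := h 1 Y
    rw [twirl_apply] at h2
    simp only [conjUnitary_one, LinearMap.comp_apply, Matrix.traceLinearMap_apply,
      LinearMap.flip_apply, LinearMap.lsmul_apply, LinearMap.smul_apply, Matrix.trace_one,
      Matrix.one_mul, smul_eq_mul, integral_const_mul] at h2
    field_simp
    linear_combination h2
  have h3 := h1 1
  simp only [conjUnitary_one, integral_const, probReal_univ, one_smul, Matrix.trace_one] at h3
  rw [h1, h3]
  field_simp

end Twirl

/-! ### Positivity of traces and of block sums -/

section PosSemidef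

variable {n : Type*} [Fintype n]

theorem re_trace_mul_nonneg [DecidableEq n] {P Q : Matrix n n ℂ} (hP : P.PosSemidef)
    (hQ : Q.PosSemidef) : 0 ≤ (P * Q).trace.re := by
  obtain ⟨R, hR, rfl⟩ := exists_posSemidef_sq hQ
  rw [← Matrix.mul_assoc, Matrix.trace_mul_comm, ← Matrix.mul_assoc]
  have := hP.conjTranspose_mul_mul_same R
  rw [hR.1.eq] at this
  exact trace_re_nonneg this

/-- Summing a positive semidefinite matrix over pairs of indices of the first factor. -/
theorem posSemidef_sum_sum {A : Type*} [Fintype A] [DecidableEq n]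
    {H : Matrix (A × n) (A × n) ℂ} (hH : H.PosSemidef) :
    (Matrix.of fun i j => ∑ a, ∑ a', H (a, i) (a', j)).PosSemidef := by
  let W : Matrix (A × n) n ℂ := Matrix.of fun p j => if p.2 = j then 1 else 0
  convert hH.conjTranspose_mul_mul_same W using 1
  ext i j
  simp only [Matrix.of_apply, Matrix.mul_apply, Matrix.conjTranspose_apply, W, apply_ite star,
    star_one, star_zero, ite_mul, one_mul, zero_mul, mul_ite, mul_one, mul_zero,
    Fintype.sum_prod_type, Finset.sum_ite_eq', Finset.mem_univ, if_true]
  exact Finset.sum_comm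

end PosSemidef

/-! ### Blocks of bipartite operators and the inverse Choi correspondence -/

section Blocks

variable {A B E : Type*}

/-- The block of an operator on `A E` at a pair of indices of `E`. -/
def blockSnd (X : Matrix (A × E) (A × E) ℂ) (e e' : E) : Matrix A A ℂ :=
  Matrix.of fun a a' => X (a, e) (a', e')

theorem blockSnd_conjTranspose {X : Matrix (A × E) (A × E) ℂ} (hX : X.IsHermitian) (e e' : E) :
    (blockSnd X e e')ᴴ = blockSnd X e' e := by
  ext a a'
  exact hX.apply _ _

variable [Fintype A]

theorem posSemidef_reduceSnd [Fintype E] {X : Matrix (A × E) (A × E) ℂ} (hX : X.PosSemidef) :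
    (reduceSnd X).PosSemidef := by
  have : reduceSnd X = ∑ a, X.submatrix (fun e => (a, e)) (fun e => (a, e)) := by
    ext e e'
    simp [reduceSnd, Matrix.sum_apply]
  rw [this]
  exact Matrix.posSemidef_sum _ fun a _ => hX.submatrix _

theorem trace_reduceSnd [Fintype E] (X : Matrix (A × E) (A × E) ℂ) :
    (reduceSnd X).trace = X.trace := by
  simp only [Matrix.trace, Matrix.diag, reduceSnd, Matrix.of_apply, Fintype.sum_prod_type]
  exact Finset.sum_comm

theorem reduceSnd_sub (X Y : Matrix (A × E) (A × E) ℂ) :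
    reduceSnd (X - Y) = reduceSnd X - reduceSnd Y := by
  ext e e'
  simp [reduceSnd]

theorem isHermitian_reduceSnd {X : Matrix (A × E) (A × E) ℂ} (hX : X.IsHermitian) :
    (reduceSnd X).IsHermitian := by
  ext e e'
  simp only [Matrix.conjTranspose_apply, reduceSnd, Matrix.of_apply, star_sum]
  exact Finset.sum_congr rfl fun a _ => hX.apply _ _

theorem trace_blockSnd (X : Matrix (A × E) (A × E) ℂ) (e e' : E) :
    (blockSnd X e e').trace = reduceSnd X e e' := rfl

theorem blockSnd_conjFst [DecidableEq A] [Fintype E] [DecidableEq E]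
    (U : Matrix.unitaryGroup A ℂ) (X : Matrix (A × E) (A × E) ℂ) (e e' : E) :
    blockSnd (conjFst U X) e e' = conjUnitary U (blockSnd X e e') := by
  ext a a'
  simp only [blockSnd, conjFst, conjUnitary, Matrix.of_apply, Matrix.mul_apply,
    Matrix.conjTranspose_kronecker, Matrix.conjTranspose_one, Matrix.kroneckerMap_apply,
    Fintype.sum_prod_type, Matrix.one_apply, mul_ite, mul_one, mul_zero, ite_mul, zero_mul,
    Finset.sum_ite_eq, Finset.sum_ite_eq', Finset.mem_univ, if_true]

theorem conjFst_sub [DecidableEq A] [Fintype E] [DecidableEq E]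
    (U : Matrix.unitaryGroup A ℂ) (X Y : Matrix (A × E) (A × E) ℂ) :
    conjFst U (X - Y) = conjFst U X - conjFst U Y := by
  simp only [conjFst, Matrix.mul_sub, Matrix.sub_mul]

theorem isHermitian_conjFst [DecidableEq A] [Fintype E] [DecidableEq E]
    (U : Matrix.unitaryGroup A ℂ) {X : Matrix (A × E) (A × E) ℂ} (hX : X.IsHermitian) :
    (conjFst U X).IsHermitian := Matrix.isHermitian_mul_mul_conjTranspose _ hX

theorem sum_hsNormSq_blockSnd [Fintype E] (X : Matrix (A × E) (A × E) ℂ) :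
    ∑ e, ∑ e', hsNormSq (blockSnd X e e') = hsNormSq X := by
  simp only [hsNormSq, Fintype.sum_prod_type, blockSnd, Matrix.of_apply]
  conv_rhs => rw [Finset.sum_comm]
  refine Finset.sum_congr rfl fun e _ => ?_
  rw [Finset.sum_comm]
  exact Finset.sum_congr rfl fun a _ => Finset.sum_comm

/-- The linear map with a given Choi operator. -/
noncomputable def choiMap (C : Matrix (A × B) (A × B) ℂ) : Matrix A A ℂ →ₗ[ℂ] Matrix B B ℂ where
  toFun X := Matrix.of fun b b' => Fintype.card A * ∑ a, ∑ a', X a a' * C (a, b) (a', b')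
  map_add' X Y := by
    ext b b'
    simp [add_mul, mul_add, Finset.sum_add_distrib]
  map_smul' c X := by
    ext b b'
    simp [Finset.mul_sum, mul_left_comm, mul_assoc]

theorem choiMap_apply (C : Matrix (A × B) (A × B) ℂ) (X : Matrix A A ℂ) (b b' : B) :
    choiMap C X b b' = Fintype.card A * ∑ a, ∑ a', X a a' * C (a, b) (a', b') := rfl

theorem isHermitian_applyFst_choiMap {C : Matrix (A × B) (A × B) ℂ} (hC : C.IsHermitian)
    {X : Matrix (A × E) (A × E) ℂ} (hX : X.IsHermitian) :
    (applyFst E (choiMap C) X).IsHermitian := by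
  ext p q
  simp only [Matrix.conjTranspose_apply, applyFst, Matrix.of_apply, choiMap_apply, star_mul',
    star_sum, hC.apply, hX.apply, star_natCast]
  rw [Finset.sum_comm]

/-- Schur product theorem: pulled back to `A × (B × E)`, `X` and `C` have a positive entrywise
product, and the output is `n` times its sum over pairs of `A`-indices. -/
theorem posSemidef_applyFst_choiMap [Fintype B] [DecidableEq B] [Fintype E] [DecidableEq E]
    {C : Matrix (A × B) (A × B) ℂ}
    (hC : C.PosSemidef) {X : Matrix (A × E) (A × E) ℂ} (hX : X.PosSemidef) :
    (applyFst E (choiMap C) X).PosSemidef := by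
  have h1 := hC.submatrix (fun p : A × (B × E) => (p.1, p.2.1))
  have h2 := hX.submatrix (fun p : A × (B × E) => (p.1, p.2.2))
  have h3 := (posSemidef_sum_sum (h2.hadamard h1)).smul
    (show (0 : ℂ) ≤ (Fintype.card A : ℂ) from Nat.cast_nonneg _)
  convert h3 using 1
  ext p q
  simp only [applyFst, choiMap_apply, Matrix.smul_apply, Matrix.of_apply, Matrix.hadamard_apply,
    Matrix.submatrix_apply, smul_eq_mul]

theorem choiMap_sub (C D : Matrix (A × B) (A × B) ℂ) : choiMap (C - D) = choiMap C - choiMap D := by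
  ext1 X
  ext b b'
  simp only [choiMap_apply, LinearMap.sub_apply, Matrix.sub_apply, mul_sub, Finset.sum_sub_distrib]

variable [DecidableEq A]

theorem choiMap_matrixUnit (C : Matrix (A × B) (A × B) ℂ) (i j : A) (b b' : B) :
    choiMap C (matrixUnit i j) b b' = Fintype.card A * C (i, b) (j, b') := by
  rw [choiMap_apply]
  congr 1
  rw [Finset.sum_eq_single i, Finset.sum_eq_single j]
  · simp
  · intro a _ ha; simp [ha.symm]
  · simp
  · intro a _ ha; simp [ha.symm]
  · simp

theorem choiMap_one (C : Matrix (A × B) (A × B) ℂ) :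
    choiMap C 1 = (Fintype.card A : ℂ) • reduceSnd C := by
  ext b b'
  simp [choiMap_apply, reduceSnd, Matrix.one_apply]

/-- The factor `|A|` in `choiMap` undoes the normalization of `Φ`. -/
theorem choiMap_choi [Nonempty A] (T : Matrix A A ℂ →ₗ[ℂ] Matrix B B ℂ) : choiMap (choi T) = T := by
  have hn : (Fintype.card A : ℂ) ≠ 0 := Nat.cast_ne_zero.2 Fintype.card_ne_zero
  have h : ∀ i j, choiMap (choi T) (matrixUnit i j) = T (matrixUnit i j) := by
    intro i j
    ext b b'
    have h2 : (Matrix.of fun a a' => maxEntangled A (i, a) (j, a')) =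
        (Fintype.card A : ℂ)⁻¹ • matrixUnit i j := by
      have hs : (((√(Fintype.card A))⁻¹ : ℝ) : ℂ) * (((√(Fintype.card A))⁻¹ : ℝ) : ℂ) =
          (Fintype.card A : ℂ)⁻¹ := by
        rw [← Complex.ofReal_mul, ← mul_inv, Real.mul_self_sqrt (Nat.cast_nonneg _)]
        simp
      ext a a'
      simp only [maxEntangled, Matrix.of_apply, Matrix.vecMulVec_apply, Matrix.smul_apply,
        Matrix.single_apply, Pi.star_apply, smul_eq_mul, ← hs, star_mul', Complex.star_def,
        Complex.conj_ofReal]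
      split_ifs <;> simp_all
    rw [choiMap_matrixUnit, choi, applySnd, Matrix.of_apply, h2, map_smul, Matrix.smul_apply,
      smul_eq_mul, mul_inv_cancel_left₀ hn]
  ext1 X
  rw [eq_sum_smul_matrixUnit X]
  simp only [map_sum, map_smul, h]

/-- The traceless part of a block. -/
noncomputable def tracelessBlock (X : Matrix (A × E) (A × E) ℂ) (e e' : E) : Matrix A A ℂ :=
  blockSnd X e e' - ((blockSnd X e e').trace / Fintype.card A) • 1

theorem trace_tracelessBlock [Nonempty A] (X : Matrix (A × E) (A × E) ℂ) (e e' : E) :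
    (tracelessBlock X e e').trace = 0 := by
  have hn : (Fintype.card A : ℂ) ≠ 0 := Nat.cast_ne_zero.2 Fintype.card_ne_zero
  simp [tracelessBlock, hn]

theorem tracelessBlock_conjTranspose {X : Matrix (A × E) (A × E) ℂ} (hX : X.IsHermitian)
    (e e' : E) : (tracelessBlock X e e')ᴴ = tracelessBlock X e' e := by
  rw [tracelessBlock, tracelessBlock, ← blockSnd_conjTranspose hX, Matrix.conjTranspose_sub,
    Matrix.conjTranspose_smul, Matrix.trace_conjTranspose, Matrix.conjTranspose_one]
  simp

/-- Removing the trace part is an orthogonal projection; it lowers the squared norm by `|tr M|² /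
n`. -/
theorem hsNormSq_tracelessBlock_le [Nonempty A] (X : Matrix (A × E) (A × E) ℂ) (e e' : E) :
    hsNormSq (tracelessBlock X e e') ≤ hsNormSq (blockSnd X e e') := by
  have hn : (0 : ℝ) < Fintype.card A := Nat.cast_pos.2 Fintype.card_pos
  rw [tracelessBlock]
  set M := blockSnd X e e'
  have h1 : hsNormSq ((M.trace / Fintype.card A) • (1 : Matrix A A ℂ)) =
      ‖M.trace‖ ^ 2 / Fintype.card A := by
    simp only [hsNormSq, Matrix.smul_apply, Matrix.one_apply, smul_eq_mul, mul_ite, mul_one,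
      mul_zero, apply_ite norm, norm_zero, ite_pow, ne_eq, OfNat.ofNat_ne_zero, not_false_eq_true,
      zero_pow, Finset.sum_ite_eq, Finset.mem_univ, if_true, Finset.sum_const, Finset.card_univ,
      norm_div, Complex.norm_natCast, nsmul_eq_mul]
    field_simp
  have h2 : (Mᴴ * ((M.trace / Fintype.card A) • (1 : Matrix A A ℂ))).trace.re =
      ‖M.trace‖ ^ 2 / Fintype.card A := by
    rw [Matrix.mul_smul, Matrix.mul_one, Matrix.trace_smul, Matrix.trace_conjTranspose, smul_eq_mul,
      div_mul_eq_mul_div, Complex.star_def, Complex.mul_conj']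
    norm_cast
  rw [hsNormSq_sub, h1, h2]
  have : 0 ≤ ‖M.trace‖ ^ 2 / Fintype.card A := by positivity
  linarith

end Blocks

/-! ### First and second moments of the deviation -/

section Deviation

variable {A B E : Type*} [Fintype A] [DecidableEq A] [Fintype E] [DecidableEq E]

/-- The deviation of the decoupled output from its mean, for a map with Choi operator `C`. -/
noncomputable def deviation (C : Matrix (A × B) (A × B) ℂ) (X : Matrix (A × E) (A × E) ℂ)
    (U : Matrix.unitaryGroup A ℂ) : Matrix (B × E) (B × E) ℂ :=
  applyFst E (choiMap C) (conjFst U X) - reduceSnd C ⊗ₖ reduceSnd X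

theorem deviation_sub_left (C D : Matrix (A × B) (A × B) ℂ) (X : Matrix (A × E) (A × E) ℂ)
    (U : Matrix.unitaryGroup A ℂ) : deviation (C - D) X U = deviation C X U - deviation D X U := by
  ext p q
  simp only [deviation, choiMap_sub, reduceSnd_sub, applyFst, Matrix.sub_apply, Matrix.of_apply,
    LinearMap.sub_apply, Matrix.kroneckerMap_apply]
  ring

/-- Since `T(1) = n C_B` and conjugation fixes `1`, subtracting `C_B ⊗ X_E` amounts to removing the
trace from each block of `X`. -/
theorem deviation_apply [Nonempty A] (C : Matrix (A × B) (A × B) ℂ)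
    (X : Matrix (A × E) (A × E) ℂ) (U : Matrix.unitaryGroup A ℂ) (p q : B × E) :
    deviation C X U p q = choiMap C (conjUnitary U (tracelessBlock X p.2 q.2)) p.1 q.1 := by
  have hn : (Fintype.card A : ℂ) ≠ 0 := Nat.cast_ne_zero.2 Fintype.card_ne_zero
  have h1 : conjUnitary U (tracelessBlock X p.2 q.2) = conjUnitary U (blockSnd X p.2 q.2) -
      ((blockSnd X p.2 q.2).trace / Fintype.card A) • (1 : Matrix A A ℂ) := by
    rw [tracelessBlock, sub_eq_add_neg, ← neg_smul, conjUnitary_add, conjUnitary_smul,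
      conjUnitary_one, neg_smul, ← sub_eq_add_neg]
  rw [h1, map_sub, map_smul, choiMap_one, smul_smul, div_mul_cancel₀ _ hn, deviation,
    Matrix.sub_apply, Matrix.sub_apply, ← blockSnd_conjFst, trace_blockSnd, Matrix.smul_apply,
    Matrix.kroneckerMap_apply, smul_eq_mul, mul_comm]
  rfl

theorem continuous_deviation (C : Matrix (A × B) (A × B) ℂ) (X : Matrix (A × E) (A × E) ℂ) :
    Continuous (deviation C X) := by
  refine continuous_matrix fun p q => ?_
  simp only [deviation, Matrix.sub_apply]
  refine Continuous.sub ?_ continuous_const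
  let f : Matrix A A ℂ →ₗ[ℂ] ℂ := Matrix.entryLinearMap ℂ ℂ p.1 q.1 ∘ₗ choiMap C
  have : (fun U => applyFst E (choiMap C) (conjFst U X) p q) =
      fun U => f (conjUnitary U (blockSnd X p.2 q.2)) := by
    ext U
    rw [← blockSnd_conjFst]
    rfl
  rw [this]
  exact f.continuous_of_finiteDimensional.comp (continuous_conjUnitary _)

theorem isHermitian_deviation {C : Matrix (A × B) (A × B) ℂ} (hC : C.IsHermitian)
    {X : Matrix (A × E) (A × E) ℂ} (hX : X.IsHermitian) (U : Matrix.unitaryGroup A ℂ) :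
    (deviation C X U).IsHermitian := by
  refine (isHermitian_applyFst_choiMap hC (isHermitian_conjFst U hX)).sub ?_
  rw [Matrix.IsHermitian, Matrix.conjTranspose_kronecker, (isHermitian_reduceSnd hC).eq,
    (isHermitian_reduceSnd hX).eq]

variable [Fintype B]

theorem continuous_traceNorm_deviation [DecidableEq B] (C : Matrix (A × B) (A × B) ℂ)
    (X : Matrix (A × E) (A × E) ℂ) : Continuous fun U => traceNorm (deviation C X U) :=
  continuous_traceNorm.comp (continuous_deviation C X)

theorem integrable_of_continuous_real {f : Matrix.unitaryGroup A ℂ → ℝ} (hf : Continuous f) :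
    Integrable f (haarUnitary A) :=
  hf.integrable_of_hasCompactSupport (HasCompactSupport.of_compactSpace f)

/-- First moment bound. -/
theorem integral_traceNorm_deviation_le [DecidableEq B] [Nonempty A]
    {C : Matrix (A × B) (A × B) ℂ} (hC : C.PosSemidef) {X : Matrix (A × E) (A × E) ℂ}
    (hX : X.PosSemidef) :
    ∫ U, traceNorm (deviation C X U) ∂haarUnitary A ≤ 2 * (C.trace.re * X.trace.re) := by
  have hn : (Fintype.card A : ℂ) ≠ 0 := Nat.cast_ne_zero.2 Fintype.card_ne_zero
  let f : Matrix A A ℂ →ₗ[ℂ] ℂ := Matrix.traceLinearMap B ℂ ℂ ∘ₗ choiMap C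
  -- The trace of the output depends only on `X_A`, so the first moment formula applies to it.
  have htr : ∀ U, (applyFst E (choiMap C) (conjFst U X)).trace =
      f (conjUnitary U (∑ e, blockSnd X e e)) := by
    intro U
    have : conjUnitary U (∑ e, blockSnd X e e) = ∑ e, blockSnd (conjFst U X) e e := by
      simp only [blockSnd_conjFst, conjUnitary, Finset.mul_sum, Finset.sum_mul]
    rw [this]
    simp only [f, LinearMap.comp_apply, map_sum, Matrix.traceLinearMap_apply, Matrix.trace,
      Matrix.diag, applyFst, Matrix.of_apply, Fintype.sum_prod_type, blockSnd]
    exact Finset.sum_comm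
  have hf : Continuous fun U => f (conjUnitary U (∑ e, blockSnd X e e)) :=
    f.continuous_of_finiteDimensional.comp (continuous_conjUnitary _)
  have hfre : Continuous fun U => (f (conjUnitary U (∑ e, blockSnd X e e))).re :=
    Complex.continuous_re.comp hf
  have hCim : C.trace = C.trace.re := by
    apply Complex.ext <;> simp [← (Complex.nonneg_iff.1 hC.trace_nonneg).2]
  have hXim : X.trace = X.trace.re := by
    apply Complex.ext <;> simp [← (Complex.nonneg_iff.1 hX.trace_nonneg).2]
  have hint : ∫ U, f (conjUnitary U (∑ e, blockSnd X e e)) ∂haarUnitary A =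
      ((C.trace.re * X.trace.re : ℝ) : ℂ) := by
    have h1 : f 1 = Fintype.card A * C.trace := by
      simp only [f, LinearMap.comp_apply, choiMap_one, Matrix.traceLinearMap_apply,
        Matrix.trace_smul, trace_reduceSnd, smul_eq_mul]
    have h2 : (∑ e, blockSnd X e e).trace = X.trace := by
      rw [Matrix.trace_sum]
      simp only [trace_blockSnd]
      exact trace_reduceSnd X
    rw [integral_conjUnitary, h1, h2, Complex.ofReal_mul, ← hCim, ← hXim]
    field_simp
  have hkr : (reduceSnd C ⊗ₖ reduceSnd X).trace.re = C.trace.re * X.trace.re := by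
    rw [Matrix.trace_kronecker, trace_reduceSnd, trace_reduceSnd, hCim, hXim,
      ← Complex.ofReal_mul]
    simp only [Complex.ofReal_re]
  have hpt : ∀ U, traceNorm (deviation C X U) ≤
      (f (conjUnitary U (∑ e, blockSnd X e e))).re + C.trace.re * X.trace.re := by
    intro U
    refine (traceNorm_sub_le _ _).trans ?_
    have hU : (conjFst U X).PosSemidef := hX.mul_mul_conjTranspose_same _
    rw [traceNorm_of_posSemidef (posSemidef_applyFst_choiMap hC hU),
      traceNorm_of_posSemidef ((posSemidef_reduceSnd hC).kronecker (posSemidef_reduceSnd hX)),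
      hkr, htr]
  refine (integral_mono (integrable_of_continuous_real (continuous_traceNorm_deviation C X))
    ((integrable_of_continuous_real hfre).add (integrable_const (C.trace.re * X.trace.re)))
    hpt).trans ?_
  have hre : ∫ U, (f (conjUnitary U (∑ e, blockSnd X e e))).re ∂haarUnitary A =
      C.trace.re * X.trace.re := by
    have := integral_re (integrable_of_continuous hf)
    simp only [RCLike.re_to_complex] at this
    rw [this, hint, Complex.ofReal_re]
  rw [integral_add' (integrable_of_continuous_real hfre) (integrable_const _), hre]
  simp only [integral_const, probReal_univ, one_smul]
  linarith

/-- The blocks of `C` are `D_aa' = Y_a† Y_a'`, so `‖D_aa'‖₂² ≤ ‖D_aa‖₂ ‖D_a'a'‖₂` by Cauchy-Schwarz.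
Summation yields at most `n ∑ ‖D_aa‖₂²`, and `∑ ‖D_aa‖₂² ≤ ‖C_B‖₂²` because the cross terms `tr
(D_aa D_a'a')` are nonnegative. -/
theorem hsNormSq_le_card_mul_reduceSnd [DecidableEq B] {C : Matrix (A × B) (A × B) ℂ}
    (hC : C.PosSemidef) : hsNormSq C ≤ Fintype.card A * hsNormSq (reduceSnd C) := by
  obtain ⟨R, hR, hRR⟩ := exists_posSemidef_sq hC
  let Y : A → Matrix (A × B) B ℂ := fun a => Matrix.of fun k b => R k (a, b)
  let D : A → A → Matrix B B ℂ := fun a a' => Matrix.of fun b b' => C (a, b) (a', b')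
  have hD : ∀ a a', D a a' = (Y a)ᴴ * Y a' := by
    intro a a'
    ext b b'
    simp only [D, Y, Matrix.of_apply, Matrix.mul_apply, Matrix.conjTranspose_apply, ← hRR,
      hR.1.apply]
  have hsD : ∀ a a', hsNormSq (D a a') ≤ √(hsNormSq (D a a)) * √(hsNormSq (D a' a')) := by
    intro a a'
    have h1 : ∀ a, hsNormSq (Y a * (Y a)ᴴ) = hsNormSq (D a a) := by
      intro a
      rw [hD, hsNormSq_eq_re_trace, hsNormSq_eq_re_trace]
      simp only [Matrix.conjTranspose_mul, Matrix.conjTranspose_conjTranspose]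
      rw [Matrix.mul_assoc, Matrix.trace_mul_comm]
      simp only [Matrix.mul_assoc]
    have h2 : hsNormSq (D a a') = ((Y a * (Y a)ᴴ) * (Y a' * (Y a')ᴴ)).trace.re := by
      rw [hD, hsNormSq_eq_re_trace]
      simp only [Matrix.conjTranspose_mul, Matrix.conjTranspose_conjTranspose]
      rw [Matrix.mul_assoc, Matrix.trace_mul_comm]
      simp only [Matrix.mul_assoc]
    rw [h2, ← h1, ← h1]
    exact (Complex.re_le_norm _).trans (norm_trace_mul_le _ _)
  have hsum : hsNormSq C = ∑ a, ∑ a', hsNormSq (D a a') := by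
    simp only [hsNormSq, Fintype.sum_prod_type, D, Matrix.of_apply]
    exact Finset.sum_congr rfl fun a _ => Finset.sum_comm
  have hDpos : ∀ a, (D a a).PosSemidef := fun a => hC.submatrix fun b => (a, b)
  have hred : reduceSnd C = ∑ a, D a a := by
    ext b b'
    simp [reduceSnd, D, Matrix.sum_apply]
  have hdiag : ∑ a, hsNormSq (D a a) ≤ hsNormSq (reduceSnd C) := by
    rw [hsNormSq_of_isHermitian (posSemidef_reduceSnd hC).1, hred, Finset.sum_mul_sum,
      Matrix.trace_sum, Complex.re_sum]
    refine Finset.sum_le_sum fun a _ => ?_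
    rw [Matrix.trace_sum, Complex.re_sum, hsNormSq_of_isHermitian (hDpos a).1]
    exact Finset.single_le_sum (f := fun a' => (D a a * D a' a').trace.re)
      (fun a' _ => re_trace_mul_nonneg (hDpos a) (hDpos a')) (Finset.mem_univ a)
  calc hsNormSq C ≤ ∑ a, ∑ a', √(hsNormSq (D a a)) * √(hsNormSq (D a' a')) := by
        rw [hsum]
        exact Finset.sum_le_sum fun a _ => Finset.sum_le_sum fun a' _ => hsD a a'
    _ = (∑ a, √(hsNormSq (D a a))) ^ 2 := by rw [sq, Finset.sum_mul_sum]
    _ ≤ Fintype.card A * ∑ a, √(hsNormSq (D a a)) ^ 2 := sq_sum_le_card_mul_sum_sq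
    _ = Fintype.card A * ∑ a, hsNormSq (D a a) := by
        simp only [Real.sq_sqrt (hsNormSq_nonneg _)]
    _ ≤ _ := mul_le_mul_of_nonneg_left hdiag (Nat.cast_nonneg _)

/-- Second moment bound. -/
theorem integral_hsNormSq_deviation_le [DecidableEq B] [Nonempty A]
    {C : Matrix (A × B) (A × B) ℂ} (hC : C.PosSemidef) {X : Matrix (A × E) (A × E) ℂ}
    (hX : X.IsHermitian) :
    ∫ U, hsNormSq (deviation C X U) ∂haarUnitary A ≤ hsNormSq C * hsNormSq X := by
  have hC0 := hsNormSq_nonneg C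
  let G : Matrix A A ℂ →ₗ[ℂ] Matrix A A ℂ →ₗ[ℂ] ℂ :=
    ((LinearMap.mul ℂ (Matrix B B ℂ)).compr₂ (Matrix.traceLinearMap B ℂ ℂ)).compl₁₂
      (choiMap C) (choiMap C)
  have hG : ∀ X Y, G X Y = (choiMap C X * choiMap C Y).trace := fun X Y => rfl
  obtain ⟨α, hα, hαn⟩ := exists_second_moment G
  have hdev : ∀ U, ((hsNormSq (deviation C X U) : ℝ) : ℂ) = ∑ e, ∑ e',
      G (conjUnitary U (tracelessBlock X e e')) (conjUnitary U (tracelessBlock X e' e)) := by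
    intro U
    rw [← trace_conjTranspose_mul_self_eq, (isHermitian_deviation hC.1 hX U).eq]
    simp only [hG, Matrix.trace, Matrix.diag, Matrix.mul_apply, deviation_apply,
      Fintype.sum_prod_type]
    rw [Finset.sum_comm]
    refine Finset.sum_congr rfl fun e _ => ?_
    conv_rhs => rw [Finset.sum_comm]
    exact Finset.sum_congr rfl fun b _ => Finset.sum_comm
  have hint : ((∫ U, hsNormSq (deviation C X U) ∂haarUnitary A : ℝ) : ℂ) =
      α * ((∑ e, ∑ e', hsNormSq (tracelessBlock X e e') : ℝ) : ℂ) := by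
    rw [← integral_complex_ofReal]
    simp only [hdev]
    rw [integral_finsetSum Finset.univ fun e _ => integrable_finsetSum _ fun e' _ =>
      integrable_of_continuous (continuous_bilin G _ _)]
    push_cast
    rw [Finset.mul_sum]
    refine Finset.sum_congr rfl fun e _ => ?_
    rw [integral_finsetSum Finset.univ fun e' _ =>
      integrable_of_continuous (continuous_bilin G _ _), Finset.mul_sum]
    refine Finset.sum_congr rfl fun e' _ => ?_
    rw [hα _ _ (trace_tracelessBlock X e e'), ← trace_conjTranspose_mul_self_eq,
      tracelessBlock_conjTranspose hX, Matrix.trace_mul_comm]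
  set W := ∑ e, ∑ e', hsNormSq (tracelessBlock X e e') with hW
  have hW0 : 0 ≤ W := Finset.sum_nonneg fun _ _ => Finset.sum_nonneg fun _ _ => hsNormSq_nonneg _
  have hWX : W ≤ hsNormSq X := by
    rw [← sum_hsNormSq_blockSnd]
    exact Finset.sum_le_sum fun e _ => Finset.sum_le_sum fun e' _ =>
      hsNormSq_tracelessBlock_le X e e'
  have hre : ∫ U, hsNormSq (deviation C X U) ∂haarUnitary A = α.re * W := by
    have := congrArg Complex.re hint
    rwa [Complex.ofReal_re, Complex.re_mul_ofReal] at this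
  rcases subsingleton_or_nontrivial A with hA | hA
  -- For `n = 1` the equation for `α` is void, but traceless one-by-one blocks vanish.
  · have hz : W = 0 := by
      refine Finset.sum_eq_zero fun e _ => Finset.sum_eq_zero fun e' _ => ?_
      have : tracelessBlock X e e' = 0 := by
        obtain ⟨a⟩ := ‹Nonempty A›
        have ht := trace_tracelessBlock X e e'
        have : Unique A := ⟨⟨a⟩, fun b => Subsingleton.elim b a⟩
        ext i j
        rw [Matrix.trace, Fintype.sum_unique] at ht
        rw [Subsingleton.elim i default, Subsingleton.elim j default]
        exact ht
      simp [this, hsNormSq]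
    rw [hre, hz, mul_zero]
    exact mul_nonneg hC0 (hsNormSq_nonneg X)
  · have hcontr : contraction G = (Fintype.card A : ℂ) ^ 2 * hsNormSq C := by
      rw [← trace_conjTranspose_mul_self_eq, hC.1.eq]
      simp only [contraction, hG, Matrix.trace, Matrix.diag, Matrix.mul_apply, choiMap_matrixUnit,
        Fintype.sum_prod_type, Finset.mul_sum]
      refine Finset.sum_congr rfl fun i _ => ?_
      rw [Finset.sum_comm]
      exact Finset.sum_congr rfl fun b _ => Finset.sum_congr rfl fun j _ =>
        Finset.sum_congr rfl fun b' _ => by ring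
    have hone : G 1 1 = (Fintype.card A : ℂ) ^ 2 * hsNormSq (reduceSnd C) := by
      rw [hG, choiMap_one, ← trace_conjTranspose_mul_self_eq, (isHermitian_reduceSnd hC.1).eq]
      simp only [Matrix.smul_mul, Matrix.mul_smul, Matrix.trace_smul, smul_eq_mul]
      ring
    have hn : (1 : ℝ) < Fintype.card A := Nat.one_lt_cast.2 Fintype.one_lt_card
    have hαre : α.re * ((Fintype.card A : ℝ) ^ 3 - Fintype.card A) =
        (Fintype.card A : ℝ) ^ 3 * hsNormSq C - (Fintype.card A : ℝ) ^ 2 * hsNormSq (reduceSnd C) := by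
      rw [hcontr, hone] at hαn
      have h1 : α * (((Fintype.card A : ℝ) ^ 3 - Fintype.card A : ℝ) : ℂ) =
          (((Fintype.card A : ℝ) ^ 3 * hsNormSq C -
            (Fintype.card A : ℝ) ^ 2 * hsNormSq (reduceSnd C) : ℝ) : ℂ) := by
        push_cast
        rw [hαn]
        ring
      have := congrArg Complex.re h1
      rwa [Complex.ofReal_re, Complex.re_mul_ofReal] at this
    have hle := hsNormSq_le_card_mul_reduceSnd hC
    have hαle : α.re ≤ hsNormSq C := by
      have hpos : 0 < (Fintype.card A : ℝ) ^ 3 - Fintype.card A := by nlinarith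
      refine le_of_mul_le_mul_right ?_ hpos
      rw [hαre]
      nlinarith
    rw [hre]
    exact (mul_le_mul_of_nonneg_right hαle hW0).trans (mul_le_mul_of_nonneg_left hWX hC0)

end Deviation

/-! ### Weighted Hilbert-Schmidt bounds -/

section Weights

variable {n : Type*} [Fintype n] [DecidableEq n]

/-- The left side is `tr (K² · V† K² V)`, to which Cauchy-Schwarz and unitary invariance apply. -/
theorem hsNormSq_mul_unitary_mul_le {K : Matrix n n ℂ} (hK : K.IsHermitian)
    (V : Matrix.unitaryGroup n ℂ) :
    hsNormSq (K * (V : Matrix n n ℂ) * K) ≤ hsNormSq (K * K) := by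
  have h : hsNormSq (K * (V : Matrix n n ℂ) * K) =
      ((K * K) * ((star V : Matrix.unitaryGroup n ℂ) * (K * K) * (V : Matrix n n ℂ))).trace.re := by
    have h1 : (K * (V : Matrix n n ℂ) * K)ᴴ * (K * (V : Matrix n n ℂ) * K) =
        K * ((V : Matrix n n ℂ)ᴴ * (K * K) * (V : Matrix n n ℂ) * K) := by
      simp only [Matrix.conjTranspose_mul, hK.eq, Matrix.mul_assoc]
    rw [hsNormSq_eq_re_trace, Unitary.coe_star, Matrix.star_eq_conjTranspose, h1,
      Matrix.trace_mul_comm, Matrix.mul_assoc _ K K, Matrix.trace_mul_comm]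
  rw [h]
  refine (Complex.re_le_norm _).trans ((norm_trace_mul_le _ _).trans ?_)
  rw [hsNormSq_mul_unitary, hsNormSq_unitary_mul, Real.mul_self_sqrt (hsNormSq_nonneg _)]

/-- A weighted Hilbert-Schmidt bound on the trace norm. -/
theorem traceNorm_conj_le {K : Matrix n n ℂ} (hK : K.IsHermitian) (h1 : hsNormSq (K * K) ≤ 1)
    (M : Matrix n n ℂ) : traceNorm (K * M * K) ≤ √(hsNormSq M) := by
  obtain ⟨V, hV⟩ := exists_unitary_trace_eq (K * M * K)
  have : ((V : Matrix n n ℂ) * (K * M * K)).trace = (K * (V : Matrix n n ℂ) * K * M).trace := by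
    rw [← Matrix.mul_assoc, Matrix.trace_mul_comm]
    simp only [Matrix.mul_assoc]
  rw [← hV, this]
  refine (Complex.re_le_norm _).trans ((norm_trace_mul_le _ _).trans ?_)
  have h2 : √(hsNormSq (K * (V : Matrix n n ℂ) * K)) ≤ 1 :=
    Real.sqrt_le_one.2 ((hsNormSq_mul_unitary_mul_le hK V).trans h1)
  exact mul_le_of_le_one_left (Real.sqrt_nonneg _) h2

/-- A positive definite matrix has an invertible Hermitian fourth root. -/
theorem exists_fourth_root {σ : Matrix n n ℂ} (hσ : σ.PosDef) :
    ∃ K L : Matrix n n ℂ, K.IsHermitian ∧ L.IsHermitian ∧ K * L = 1 ∧ L * K = 1 ∧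
      K * K * (K * K) = σ := by
  obtain ⟨S, hS, hSS⟩ := exists_posSemidef_sq hσ.posSemidef
  obtain ⟨K, hK, hKK⟩ := exists_posSemidef_sq hS
  have hu : IsUnit K.det := by
    have := (Matrix.isUnit_iff_isUnit_det _).1 hσ.isUnit
    rw [← hSS, ← hKK, Matrix.det_mul, Matrix.det_mul] at this
    exact (IsUnit.mul_iff.1 (IsUnit.mul_iff.1 this).1).1
  exact ⟨K, K⁻¹, hK.1, hK.1.inv, Matrix.mul_nonsing_inv _ hu, Matrix.nonsing_inv_mul _ hu,
    by rw [hKK, hSS]⟩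

end Weights

theorem sum_four_comm {B E A : Type*} [Fintype B] [Fintype E] [Fintype A] {f : B → E → A → A → ℂ} :
    ∑ b, ∑ e, ∑ a, ∑ a', f b e a a' = ∑ a, ∑ a', ∑ b, ∑ e, f b e a a' := by
  calc ∑ b, ∑ e, ∑ a, ∑ a', f b e a a' = ∑ b, ∑ a, ∑ e, ∑ a', f b e a a' :=
        Finset.sum_congr rfl fun b _ => Finset.sum_comm
    _ = ∑ a, ∑ b, ∑ e, ∑ a', f b e a a' := Finset.sum_comm
    _ = ∑ a, ∑ b, ∑ a', ∑ e, f b e a a' := Finset.sum_congr rfl fun a _ =>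
        Finset.sum_congr rfl fun b _ => Finset.sum_comm
    _ = ∑ a, ∑ a', ∑ b, ∑ e, f b e a a' := Finset.sum_congr rfl fun a _ => Finset.sum_comm

theorem applyFst_choiMap_apply {A B E : Type*} [Fintype A] (C : Matrix (A × B) (A × B) ℂ)
    (X : Matrix (A × E) (A × E) ℂ) (b b' : B) (e e' : E) :
    applyFst E (choiMap C) X (b, e) (b', e') =
      Fintype.card A * ∑ a, ∑ a', X (a, e) (a', e') * C (a, b) (a', b') := rfl

/-! ### Local weights on `B` and `E` -/

section Local

variable {A B E : Type*} [Fintype A] [DecidableEq A] [Fintype B] [Fintype E]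

theorem one_kronecker_mul_apply (L : Matrix B B ℂ) (C : Matrix (A × B) (A × B) ℂ) (a : A) (b : B)
    (q : A × B) : (((1 : Matrix A A ℂ) ⊗ₖ L) * C) (a, b) q = ∑ b', L b b' * C (a, b') q := by
  simp only [Matrix.mul_apply, Matrix.kroneckerMap_apply, Matrix.one_apply, ite_mul, one_mul,
    zero_mul, Fintype.sum_prod_type]
  rw [Finset.sum_comm]
  simp

theorem mul_one_kronecker_apply (L : Matrix B B ℂ) (C : Matrix (A × B) (A × B) ℂ) (a : A) (b : B)
    (p : A × B) : (C * ((1 : Matrix A A ℂ) ⊗ₖ L)) p (a, b) = ∑ b', C p (a, b') * L b' b := by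
  simp only [Matrix.mul_apply, Matrix.kroneckerMap_apply, Matrix.one_apply, ite_mul, one_mul,
    zero_mul, mul_ite, mul_zero, Fintype.sum_prod_type]
  rw [Finset.sum_comm]
  simp

theorem reduceSnd_one_kronecker_mul (L : Matrix B B ℂ) (C : Matrix (A × B) (A × B) ℂ) :
    reduceSnd (((1 : Matrix A A ℂ) ⊗ₖ L) * C) = L * reduceSnd C := by
  ext b b'
  rw [Matrix.mul_apply]
  simp only [reduceSnd, Matrix.of_apply, one_kronecker_mul_apply, Finset.mul_sum]
  exact Finset.sum_comm

theorem reduceSnd_mul_one_kronecker (L : Matrix B B ℂ) (C : Matrix (A × B) (A × B) ℂ) :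
    reduceSnd (C * ((1 : Matrix A A ℂ) ⊗ₖ L)) = reduceSnd C * L := by
  ext b b'
  rw [Matrix.mul_apply]
  simp only [reduceSnd, Matrix.of_apply, mul_one_kronecker_apply, Finset.sum_mul]
  exact Finset.sum_comm

theorem applyFst_choiMap_kronecker_mul (L : Matrix B B ℂ) (M : Matrix E E ℂ)
    (C : Matrix (A × B) (A × B) ℂ) (X : Matrix (A × E) (A × E) ℂ) :
    applyFst E (choiMap (((1 : Matrix A A ℂ) ⊗ₖ L) * C)) (((1 : Matrix A A ℂ) ⊗ₖ M) * X) =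
      (L ⊗ₖ M) * applyFst E (choiMap C) X := by
  ext ⟨b, e⟩ ⟨b', e'⟩
  rw [Matrix.mul_apply, Fintype.sum_prod_type]
  simp only [applyFst_choiMap_apply, one_kronecker_mul_apply, Matrix.kroneckerMap_apply]
  conv_rhs => simp only [Finset.mul_sum]
  rw [sum_four_comm, Finset.mul_sum]
  refine Finset.sum_congr rfl fun a _ => ?_
  rw [Finset.mul_sum]
  refine Finset.sum_congr rfl fun a' _ => ?_
  rw [Finset.sum_mul_sum, Finset.sum_comm, Finset.mul_sum]
  refine Finset.sum_congr rfl fun b1 _ => ?_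
  rw [Finset.mul_sum]
  exact Finset.sum_congr rfl fun e1 _ => by ring

theorem applyFst_choiMap_mul_kronecker (L : Matrix B B ℂ) (M : Matrix E E ℂ)
    (C : Matrix (A × B) (A × B) ℂ) (X : Matrix (A × E) (A × E) ℂ) :
    applyFst E (choiMap (C * ((1 : Matrix A A ℂ) ⊗ₖ L))) (X * ((1 : Matrix A A ℂ) ⊗ₖ M)) =
      applyFst E (choiMap C) X * (L ⊗ₖ M) := by
  ext ⟨b, e⟩ ⟨b', e'⟩
  rw [Matrix.mul_apply, Fintype.sum_prod_type]
  simp only [applyFst_choiMap_apply, mul_one_kronecker_apply, Matrix.kroneckerMap_apply]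
  conv_rhs => simp only [Finset.mul_sum, Finset.sum_mul]
  rw [sum_four_comm, Finset.mul_sum]
  refine Finset.sum_congr rfl fun a _ => ?_
  rw [Finset.mul_sum]
  refine Finset.sum_congr rfl fun a' _ => ?_
  rw [Finset.sum_mul_sum, Finset.sum_comm, Finset.mul_sum]
  refine Finset.sum_congr rfl fun b1 _ => ?_
  rw [Finset.mul_sum]
  exact Finset.sum_congr rfl fun e1 _ => by ring

variable [DecidableEq E]

theorem conjFst_local (U : Matrix.unitaryGroup A ℂ) (L M : Matrix E E ℂ)
    (X : Matrix (A × E) (A × E) ℂ) :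
    conjFst U (((1 : Matrix A A ℂ) ⊗ₖ L) * X * ((1 : Matrix A A ℂ) ⊗ₖ M)) =
      ((1 : Matrix A A ℂ) ⊗ₖ L) * conjFst U X * ((1 : Matrix A A ℂ) ⊗ₖ M) := by
  have h1 : ((U : Matrix A A ℂ) ⊗ₖ (1 : Matrix E E ℂ)) * ((1 : Matrix A A ℂ) ⊗ₖ L) =
      ((1 : Matrix A A ℂ) ⊗ₖ L) * ((U : Matrix A A ℂ) ⊗ₖ (1 : Matrix E E ℂ)) := by
    simp only [← Matrix.mul_kronecker_mul, Matrix.one_mul, Matrix.mul_one]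
  have h2 : ((1 : Matrix A A ℂ) ⊗ₖ M) * ((U : Matrix A A ℂ) ⊗ₖ (1 : Matrix E E ℂ))ᴴ =
      ((U : Matrix A A ℂ) ⊗ₖ (1 : Matrix E E ℂ))ᴴ * ((1 : Matrix A A ℂ) ⊗ₖ M) := by
    simp only [Matrix.conjTranspose_kronecker, Matrix.conjTranspose_one,
      ← Matrix.mul_kronecker_mul, Matrix.one_mul, Matrix.mul_one]
  simp only [conjFst, Matrix.mul_assoc, h2]
  simp only [← Matrix.mul_assoc, h1]

/-- Operators on `B` and `E` commute with the unitary on `A`, and a factor on the `B` side of the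
Choi operator multiplies the output of the map; both therefore pull out of the deviation. -/
theorem deviation_local (U : Matrix.unitaryGroup A ℂ) (L : Matrix B B ℂ) (M : Matrix E E ℂ)
    (C : Matrix (A × B) (A × B) ℂ) (X : Matrix (A × E) (A × E) ℂ) :
    deviation (((1 : Matrix A A ℂ) ⊗ₖ L) * C * ((1 : Matrix A A ℂ) ⊗ₖ L))
      (((1 : Matrix A A ℂ) ⊗ₖ M) * X * ((1 : Matrix A A ℂ) ⊗ₖ M)) U =
      (L ⊗ₖ M) * deviation C X U * (L ⊗ₖ M) := by
  simp only [deviation, conjFst_local, applyFst_choiMap_mul_kronecker,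
    applyFst_choiMap_kronecker_mul, reduceSnd_mul_one_kronecker, reduceSnd_one_kronecker_mul,
    Matrix.mul_kronecker_mul, Matrix.mul_sub, Matrix.sub_mul]

/-- Conjugating the domination by `1 ⊗ L` gives `C' ≤ c (1 ⊗ K²)`. Hence `tr (C'²) ≤ c tr (C' (1 ⊗
K²)) = c tr C`, as the remaining factors cancel. -/
theorem hsNormSq_local_le [DecidableEq B] {C : Matrix (A × B) (A × B) ℂ} (hC : C.PosSemidef)
    {σ K L : Matrix B B ℂ} (hL : L.IsHermitian) (hKL : K * L = 1) (hLK : L * K = 1)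
    (hσ : K * K * (K * K) = σ) {c : ℝ}
    (h : (c • ((1 : Matrix A A ℂ) ⊗ₖ σ) - C).PosSemidef) :
    hsNormSq (((1 : Matrix A A ℂ) ⊗ₖ L) * C * ((1 : Matrix A A ℂ) ⊗ₖ L)) ≤ c * C.trace.re := by
  set N : Matrix (A × B) (A × B) ℂ := (1 : Matrix A A ℂ) ⊗ₖ L with hN
  have hNh : Nᴴ = N := by rw [hN, Matrix.conjTranspose_kronecker, Matrix.conjTranspose_one, hL.eq]
  have hD : (N * C * N).PosSemidef := by
    have := hC.mul_mul_conjTranspose_same N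
    rwa [hNh] at this
  have hLσ : L * σ * L = K * K := by
    rw [← hσ]
    calc L * (K * K * (K * K)) * L = (L * K) * K * K * (K * L) := by noncomm_ring
      _ = K * K := by rw [hLK, hKL, Matrix.one_mul, Matrix.mul_one]
  have hdiff : (c • ((1 : Matrix A A ℂ) ⊗ₖ (K * K)) - N * C * N).PosSemidef := by
    have := h.mul_mul_conjTranspose_same N
    rw [hNh, Matrix.mul_sub, Matrix.sub_mul, Matrix.mul_smul, Matrix.smul_mul] at this
    rwa [hN, ← Matrix.mul_kronecker_mul, ← Matrix.mul_kronecker_mul, Matrix.one_mul,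
      Matrix.one_mul, hLσ, ← hN] at this
  have hpos := re_trace_mul_nonneg hD hdiff
  have htr : (N * C * N * ((1 : Matrix A A ℂ) ⊗ₖ (K * K))).trace = C.trace := by
    have h1 : N * ((1 : Matrix A A ℂ) ⊗ₖ (K * K)) * N = 1 := by
      rw [hN, ← Matrix.mul_kronecker_mul, ← Matrix.mul_kronecker_mul, Matrix.one_mul,
        Matrix.one_mul, ← Matrix.mul_assoc, hLK, Matrix.one_mul, hKL, Matrix.one_kronecker_one]
    rw [Matrix.mul_assoc, Matrix.mul_assoc, Matrix.trace_mul_comm, Matrix.mul_assoc, h1,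
      Matrix.mul_one]
  rw [Matrix.mul_sub, Matrix.mul_smul, Matrix.trace_sub, Matrix.trace_smul, htr, Complex.sub_re,
    Complex.smul_re, smul_eq_mul] at hpos
  rw [hsNormSq_of_isHermitian hD.1]
  linarith

/-- Decoupling for positive operators dominated by products. -/
theorem integral_traceNorm_deviation_le_of_dominated [DecidableEq B] [Nonempty A]
    {C : Matrix (A × B) (A × B) ℂ} (hC : IsSubnormalized C)
    {X : Matrix (A × E) (A × E) ℂ} (hX : IsSubnormalized X)
    {ω : Matrix B B ℂ} (hω : ω.PosDef) (hω1 : ω.trace = 1)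
    {σ : Matrix E E ℂ} (hσ : σ.PosDef) (hσ1 : σ.trace = 1) {l m : ℝ}
    (hCω : (((2 : ℝ) ^ (-l)) • ((1 : Matrix A A ℂ) ⊗ₖ ω) - C).PosSemidef)
    (hXσ : (((2 : ℝ) ^ (-m)) • ((1 : Matrix A A ℂ) ⊗ₖ σ) - X).PosSemidef) :
    ∫ U, traceNorm (deviation C X U) ∂haarUnitary A ≤ (2 : ℝ) ^ (-(l + m) / 2) := by
  obtain ⟨K, L, hK, hL, hKL, hLK, hKω⟩ := exists_fourth_root hω
  obtain ⟨K', L', hK', hL', hKL', hLK', hKσ⟩ := exists_fourth_root hσ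
  set C' := ((1 : Matrix A A ℂ) ⊗ₖ L) * C * ((1 : Matrix A A ℂ) ⊗ₖ L) with hC'
  set X' := ((1 : Matrix A A ℂ) ⊗ₖ L') * X * ((1 : Matrix A A ℂ) ⊗ₖ L') with hX'
  have hC'p : C'.PosSemidef := by
    have := hC.1.mul_mul_conjTranspose_same ((1 : Matrix A A ℂ) ⊗ₖ L)
    rwa [Matrix.conjTranspose_kronecker, Matrix.conjTranspose_one, hL.eq] at this
  have hX'p : X'.PosSemidef := by
    have := hX.1.mul_mul_conjTranspose_same ((1 : Matrix A A ℂ) ⊗ₖ L')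
    rwa [Matrix.conjTranspose_kronecker, Matrix.conjTranspose_one, hL'.eq] at this
  have hCs : hsNormSq C' ≤ (2 : ℝ) ^ (-l) :=
    (hsNormSq_local_le hC.1 hL hKL hLK hKω hCω).trans
      (mul_le_of_le_one_right (by positivity) hC.2)
  have hXs : hsNormSq X' ≤ (2 : ℝ) ^ (-m) :=
    (hsNormSq_local_le hX.1 hL' hKL' hLK' hKσ hXσ).trans
      (mul_le_of_le_one_right (by positivity) hX.2)
  set c : ℝ := (2 : ℝ) ^ (-(l + m) / 2) with hc
  have hc0 : 0 < c := by positivity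
  have hcc : (2 : ℝ) ^ (-l) * (2 : ℝ) ^ (-m) = c * c := by
    rw [hc, ← Real.rpow_add two_pos, ← Real.rpow_add two_pos]
    congr 1
    ring
  have hint : ∫ U, hsNormSq (deviation C' X' U) ∂haarUnitary A ≤ c * c :=
    (integral_hsNormSq_deviation_le hC'p hX'p.1).trans
      ((mul_le_mul hCs hXs (hsNormSq_nonneg _) (by positivity)).trans hcc.le)
  -- The linear bound `√s ≤ c/2 + s/(2c)` replaces Jensen's inequality; it loses nothing because
  -- `c²` is the bound on the mean of `s`.
  have hpt : ∀ U, traceNorm (deviation C X U) ≤ c / 2 + (2 * c)⁻¹ * hsNormSq (deviation C' X' U) := by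
    intro U
    have h1 : deviation C X U = (K ⊗ₖ K') * deviation C' X' U * (K ⊗ₖ K') := by
      rw [hC', hX', deviation_local]
      have h2 : (K ⊗ₖ K') * (L ⊗ₖ L') = 1 := by
        rw [← Matrix.mul_kronecker_mul, hKL, hKL', Matrix.one_kronecker_one]
      have h3 : (L ⊗ₖ L') * (K ⊗ₖ K') = 1 := by
        rw [← Matrix.mul_kronecker_mul, hLK, hLK', Matrix.one_kronecker_one]
      calc deviation C X U = (K ⊗ₖ K' * L ⊗ₖ L') * deviation C X U * (L ⊗ₖ L' * K ⊗ₖ K') := by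
            rw [h2, h3, Matrix.one_mul, Matrix.mul_one]
        _ = _ := by simp only [Matrix.mul_assoc]
    have hKK : (K ⊗ₖ K').IsHermitian := by
      rw [Matrix.IsHermitian, Matrix.conjTranspose_kronecker, hK.eq, hK'.eq]
    have hKK2 : (K ⊗ₖ K' * (K ⊗ₖ K')).IsHermitian := by
      rw [Matrix.IsHermitian, Matrix.conjTranspose_mul, hKK.eq]
    have h4 : hsNormSq (K ⊗ₖ K' * (K ⊗ₖ K')) ≤ 1 := by
      rw [hsNormSq_of_isHermitian hKK2]
      simp only [← Matrix.mul_kronecker_mul]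
      rw [hKω, hKσ, Matrix.trace_kronecker, hω1, hσ1]
      simp
    have h5 := traceNorm_conj_le hKK h4 (deviation C' X' U)
    rw [← h1] at h5
    refine h5.trans ?_
    set s := hsNormSq (deviation C' X' U)
    have hs : √s ^ 2 = s := Real.sq_sqrt (hsNormSq_nonneg _)
    have h6 : c / 2 + (2 * c)⁻¹ * s - √s = (2 * c)⁻¹ * (c - √s) ^ 2 := by
      rw [← hs, Real.sqrt_sq (Real.sqrt_nonneg _)]
      field_simp
      ring
    have h7 : 0 ≤ (2 * c)⁻¹ * (c - √s) ^ 2 := by positivity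
    linarith
  have hI : Integrable (fun U => hsNormSq (deviation C' X' U)) (haarUnitary A) :=
    integrable_of_continuous_real (continuous_hsNormSq.comp (continuous_deviation C' X'))
  refine (integral_mono (integrable_of_continuous_real (continuous_traceNorm_deviation C X))
    ((integrable_const (c / 2)).add (hI.const_mul (2 * c)⁻¹)) hpt).trans ?_
  rw [integral_add' (integrable_const _) (hI.const_mul _), integral_const_mul]
  simp only [integral_const, probReal_univ, one_smul]
  have : (2 * c)⁻¹ * ∫ U, hsNormSq (deviation C' X' U) ∂haarUnitary A ≤ (2 * c)⁻¹ * (c * c) :=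
    mul_le_mul_of_nonneg_left hint (by positivity)
  have h2 : (2 * c)⁻¹ * (c * c) = c / 2 := by field_simp
  linarith

end Local

/-! ### Smoothing of the min-entropies -/

section Smoothing

theorem deviation_sub_right {A B E : Type*} [Fintype A] [DecidableEq A] [Fintype E]
    [DecidableEq E] (C : Matrix (A × B) (A × B) ℂ) (X Y : Matrix (A × E) (A × E) ℂ)
    (U : Matrix.unitaryGroup A ℂ) : deviation C (X - Y) U = deviation C X U - deviation C Y U := by
  have h : applyFst E (choiMap C) (conjFst U (X - Y)) =
      applyFst E (choiMap C) (conjFst U X) - applyFst E (choiMap C) (conjFst U Y) := by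
    ext p q
    rw [conjFst_sub, Matrix.sub_apply]
    simp only [applyFst, Matrix.of_apply]
    rw [← Matrix.sub_apply, ← map_sub]
    rfl
  rw [deviation, h, reduceSnd_sub, deviation, deviation]
  ext p q
  simp only [Matrix.sub_apply, Matrix.kroneckerMap_apply]
  ring

variable {A B E : Type*} [Fintype A] [DecidableEq A] [Fintype B] [DecidableEq B] [Fintype E]
  [DecidableEq E]

theorem nonempty_of_trace_eq_one {n : Type*} [Fintype n] {σ : Matrix n n ℂ} (h : σ.trace = 1) :
    Nonempty n := by
  by_contra hn
  rw [not_nonempty_iff] at hn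
  simp [Matrix.trace] at h

/-- The strict inequality leaves room to make the state invertible: a feasible `σ` at `l' > l` is
scaled by `t = 2^(-(l' - l))`, and the weight `1 - t` is spread evenly over the identity. -/
theorem exists_posDef_of_lt_minEntropy {ρ : Matrix (A × B) (A × B) ℂ} {l : ℝ}
    (h : (l : EReal) < minEntropy ρ) :
    ∃ σ : Matrix B B ℂ, σ.PosDef ∧ σ.trace = 1 ∧
      (((2 : ℝ) ^ (-l)) • ((1 : Matrix A A ℂ) ⊗ₖ σ) - ρ).PosSemidef := by
  rw [minEntropy] at h
  simp only [lt_iSup_iff] at h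
  obtain ⟨σ, hσ, l', hl', hll⟩ := h
  rw [EReal.coe_lt_coe_iff] at hll
  have hB : Nonempty B := nonempty_of_trace_eq_one hσ.2
  have hn : (0 : ℝ) < Fintype.card B := Nat.cast_pos.2 Fintype.card_pos
  set t : ℝ := (2 : ℝ) ^ (-(l' - l)) with ht
  have ht0 : 0 < t := by positivity
  have ht1 : t < 1 := Real.rpow_lt_one_of_one_lt_of_neg one_lt_two (by linarith)
  have htl : (2 : ℝ) ^ (-l) * t = (2 : ℝ) ^ (-l') := by
    rw [ht, ← Real.rpow_add two_pos]
    congr 1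
    ring
  set s : ℝ := (1 - t) / Fintype.card B with hs
  have hs0 : 0 < s := div_pos (by linarith) hn
  refine ⟨t • σ + s • 1, ?_, ?_, ?_⟩
  · exact Matrix.PosDef.posSemidef_add (hσ.1.smul ht0.le) (Matrix.PosDef.one.smul hs0)
  · rw [Matrix.trace_add, Matrix.trace_smul, Matrix.trace_smul, hσ.2, Matrix.trace_one]
    simp only [Complex.real_smul, mul_one]
    rw [← Complex.ofReal_natCast, ← Complex.ofReal_mul, ← Complex.ofReal_add, hs,
      div_mul_cancel₀ _ hn.ne']
    simp
  · have h1 : ((2 : ℝ) ^ (-l)) • ((1 : Matrix A A ℂ) ⊗ₖ (t • σ + s • (1 : Matrix B B ℂ))) - ρ =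
        (((2 : ℝ) ^ (-l')) • ((1 : Matrix A A ℂ) ⊗ₖ σ) - ρ) +
          ((2 : ℝ) ^ (-l) * s) • (1 : Matrix (A × B) (A × B) ℂ) := by
      rw [Matrix.kronecker_add, Matrix.kronecker_smul, Matrix.kronecker_smul, smul_add, smul_smul,
        smul_smul, htl, Matrix.one_kronecker_one]
      abel
    rw [h1]
    exact hl'.add (Matrix.PosSemidef.one.smul (by positivity))

theorem bot_lt_minEntropy [Nonempty B] {ρ : Matrix (A × B) (A × B) ℂ} (hρ : ρ.PosSemidef) :
    ⊥ < minEntropy ρ := by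
  have hn : (0 : ℝ) < Fintype.card B := Nat.cast_pos.2 Fintype.card_pos
  -- The maximally mixed state serves as witness; the summand `1` keeps the argument of the
  -- logarithm positive when `ρ = 0`.
  set c : ℝ := (‖ρ‖ + 1) * Fintype.card B with hc
  have hc0 : 0 < c := by positivity
  have hle : ρ ≤ (‖ρ‖ + 1) • (1 : Matrix (A × B) (A × B) ℂ) := by
    have h1 := IsSelfAdjoint.le_algebraMap_norm_self (a := ρ) hρ.1
    rw [Algebra.algebraMap_eq_smul_one] at h1
    rw [add_smul, one_smul]
    exact h1.trans (le_add_of_nonneg_right (Matrix.nonneg_iff_posSemidef.2 Matrix.PosSemidef.one))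
  have hσ : IsNormalized ((Fintype.card B : ℝ)⁻¹ • (1 : Matrix B B ℂ)) := by
    refine ⟨Matrix.PosSemidef.one.smul (by positivity), ?_⟩
    rw [Matrix.trace_smul, Matrix.trace_one, Complex.real_smul, ← Complex.ofReal_natCast,
      ← Complex.ofReal_mul, inv_mul_cancel₀ hn.ne', Complex.ofReal_one]
  have hpos : (((2 : ℝ) ^ (-(-Real.logb 2 c))) • ((1 : Matrix A A ℂ) ⊗ₖ
      ((Fintype.card B : ℝ)⁻¹ • (1 : Matrix B B ℂ))) - ρ).PosSemidef := by
    rw [neg_neg, Real.rpow_logb two_pos (by norm_num) hc0, Matrix.kronecker_smul, smul_smul, hc,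
      mul_inv_cancel_right₀ hn.ne', Matrix.one_kronecker_one]
    exact hle
  refine (EReal.bot_lt_coe (-Real.logb 2 c)).trans_le ?_
  exact le_iSup₂_of_le _ hσ (le_iSup₂_of_le (-Real.logb 2 c) hpos le_rfl)

theorem mem_smoothingBall_self {n : Type*} [Fintype n] [DecidableEq n] {ρ : Matrix n n ℂ}
    (hρ : IsSubnormalized ρ) {ε : ℝ} (hε : 0 ≤ ε) : ρ ∈ smoothingBall ε ρ := by
  refine ⟨hρ, ?_⟩
  have h1 : fidelity ρ ρ = ρ.trace.re := by
    rw [fidelity, CFC.sqrt_mul_sqrt_self ρ (Matrix.nonneg_iff_posSemidef.2 hρ.1),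
      traceNorm_of_posSemidef hρ.1]
  have h2 := hρ.2
  have h3 : genFidelity ρ ρ = 1 := by
    rw [genFidelity, h1, Real.sqrt_mul_self (by linarith)]
    ring
  rw [purifiedDist, h3]
  simpa using hε

theorem bot_lt_smoothMinEntropy [Nonempty B] {ρ : Matrix (A × B) (A × B) ℂ}
    (hρ : IsSubnormalized ρ) {ε : ℝ} (hε : 0 ≤ ε) : ⊥ < smoothMinEntropy ε ρ :=
  (bot_lt_minEntropy hρ.1).trans_le
    (le_iSup₂_of_le (f := fun ρ' (_ : ρ' ∈ smoothingBall ε ρ) => minEntropy ρ') ρ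
      (mem_smoothingBall_self hρ hε) le_rfl)

theorem integral_traceNorm_deviation_sub_le [Nonempty A] {C D : Matrix (A × B) (A × B) ℂ}
    {X Y : Matrix (A × E) (A × E) ℂ} {Z : Matrix (A × B) (A × B) ℂ} {W : Matrix (A × E) (A × E) ℂ}
    (h : ∀ U, deviation Z W U = deviation C X U - deviation D Y U) :
    ∫ U, traceNorm (deviation Z W U) ∂haarUnitary A ≤
      ∫ U, traceNorm (deviation C X U) ∂haarUnitary A +
        ∫ U, traceNorm (deviation D Y U) ∂haarUnitary A := by
  have hI : ∀ (C : Matrix (A × B) (A × B) ℂ) (X : Matrix (A × E) (A × E) ℂ),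
      Integrable (fun U => traceNorm (deviation C X U)) (haarUnitary A) := fun C X =>
    integrable_of_continuous_real (continuous_traceNorm_deviation C X)
  rw [← integral_add (hI C X) (hI D Y)]
  refine integral_mono (hI Z W) ((hI C X).add (hI D Y)) fun U => ?_
  simp only [h]
  exact traceNorm_sub_le _ _

/-- The first moment bound is applied to the two parts of the Jordan decomposition of `X`, whose
traces add up to its trace norm. -/
theorem integral_traceNorm_deviation_le_right [Nonempty A] {C : Matrix (A × B) (A × B) ℂ}
    (hC : C.PosSemidef) {X : Matrix (A × E) (A × E) ℂ} (hX : X.IsHermitian) :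
    ∫ U, traceNorm (deviation C X U) ∂haarUnitary A ≤ 2 * (C.trace.re * traceNorm X) := by
  obtain ⟨P, N, hP, hN, hPN, htr⟩ := exists_posSemidef_sub_posSemidef hX
  refine (integral_traceNorm_deviation_sub_le (C := C) (D := C) (X := P) (Y := N) fun U => by
    rw [hPN, deviation_sub_right]).trans ?_
  have h1 := integral_traceNorm_deviation_le hC hP
  have h2 := integral_traceNorm_deviation_le hC hN
  rw [← htr]
  linarith

theorem integral_traceNorm_deviation_le_left [Nonempty A] {C : Matrix (A × B) (A × B) ℂ}
    (hC : C.IsHermitian) {X : Matrix (A × E) (A × E) ℂ} (hX : X.PosSemidef) :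
    ∫ U, traceNorm (deviation C X U) ∂haarUnitary A ≤ 2 * (traceNorm C * X.trace.re) := by
  obtain ⟨P, N, hP, hN, hPN, htr⟩ := exists_posSemidef_sub_posSemidef hC
  refine (integral_traceNorm_deviation_sub_le (C := P) (D := N) (X := X) (Y := X) fun U => by
    rw [hPN, deviation_sub_left]).trans ?_
  have h1 := integral_traceNorm_deviation_le hP hX
  have h2 := integral_traceNorm_deviation_le hN hX
  rw [← htr]
  linarith

/-- Decoupling up to smoothing, below the smooth min-entropies. -/
theorem integral_traceNorm_deviation_le_of_lt [Nonempty A] {C : Matrix (A × B) (A × B) ℂ}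
    (hC : IsSubnormalized C) {X : Matrix (A × E) (A × E) ℂ} (hX : IsSubnormalized X) {ε : ℝ}
    (hε : 0 ≤ ε) {l m : ℝ} (hl : (l : EReal) < smoothMinEntropy ε C)
    (hm : (m : EReal) < smoothMinEntropy ε X) :
    ∫ U, traceNorm (deviation C X U) ∂haarUnitary A ≤ (2 : ℝ) ^ (-(l + m) / 2) + 8 * ε := by
  simp only [smoothMinEntropy, lt_iSup_iff] at hl hm
  obtain ⟨C', ⟨hC', hCC⟩, hl⟩ := hl
  obtain ⟨X', ⟨hX', hXX⟩, hm⟩ := hm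
  obtain ⟨ω, hω, hω1, hCω⟩ := exists_posDef_of_lt_minEntropy hl
  obtain ⟨σ, hσ, hσ1, hXσ⟩ := exists_posDef_of_lt_minEntropy hm
  have h1 := integral_traceNorm_deviation_le_of_dominated hC' hX' hω hω1 hσ hσ1 hCω hXσ
  have hdC := traceNorm_sub_le_two_mul hC' hC hε hCC
  have hdX := traceNorm_sub_le_two_mul hX' hX hε hXX
  have h2 := integral_traceNorm_deviation_le_left (hC'.1.1.sub hC.1.1) hX'.1
  have h3 := integral_traceNorm_deviation_le_right hC.1 (hX'.1.1.sub hX.1.1)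
  -- The pair `(C, X)` is changed to `(C, X')` and then to `(C', X')`; each change costs at most `2
  -- · 2ε`.
  have h4 := integral_traceNorm_deviation_sub_le (Z := C) (W := X) (C := C) (X := X') (D := C)
    (Y := X' - X) fun U => by rw [deviation_sub_right]; abel
  have h5 := integral_traceNorm_deviation_sub_le (Z := C) (W := X') (C := C') (X := X')
    (D := C' - C) (Y := X') fun U => by rw [deviation_sub_left]; abel
  have h6 : traceNorm (C' - C) * X'.trace.re ≤ 2 * ε :=
    (mul_le_of_le_one_right (traceNorm_nonneg _) hX'.2).trans hdC
  have h7 : C.trace.re * traceNorm (X' - X) ≤ 2 * ε :=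
    (mul_le_of_le_one_left (traceNorm_nonneg _) hC.2).trans hdX
  linarith

end Smoothing

/-! ### Complete positivity and the Choi operator -/

section CompletelyPositive

/-- A matrix of matrices as a matrix on the product index type. -/
def flatten {A B : Type*} (X : CStarMatrix A A (Matrix B B ℂ)) : Matrix (A × B) (A × B) ℂ :=
  Matrix.of fun p q => X p.1 q.1 p.2 q.2

/-- Nonnegative elements are generated additively by the `S* S`, and flattening respects products
and adjoints. -/
theorem posSemidef_flatten {A B : Type*} [Fintype A] [Fintype B] [DecidableEq B]
    {X : CStarMatrix A A (Matrix B B ℂ)} (hX : 0 ≤ X) :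
    (flatten X).PosSemidef := by
  rw [StarOrderedRing.nonneg_iff] at hX
  induction hX using AddSubmonoid.closure_induction with
  | mem X hX =>
    obtain ⟨S, rfl⟩ := hX
    have : flatten (star S * S) = (flatten S)ᴴ * flatten S := by
      ext p q
      simp only [flatten, Matrix.of_apply, Matrix.mul_apply, Matrix.conjTranspose_apply,
        Fintype.sum_prod_type, CStarMatrix.mul_apply, CStarMatrix.star_apply, Matrix.sum_apply,
        Matrix.star_apply]
    rw [this]
    exact Matrix.posSemidef_conjTranspose_mul_self _
  | zero => exact Matrix.PosSemidef.zero
  | add X Y _ _ h1 h2 => exact h1.add h2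

theorem posSemidef_choi {A B : Type*} [Fintype A] [DecidableEq A] [Fintype B] [DecidableEq B]
    [Nonempty A] (T : Matrix A A ℂ →CP Matrix B B ℂ) :
    (choi T.toLinearMap).PosSemidef := by
  obtain ⟨a₀⟩ := ‹Nonempty A›
  let M : CStarMatrix A A (Matrix A A ℂ) := CStarMatrix.ofMatrix (Matrix.of matrixUnit)
  -- `N` has the single nonzero row `a₀`, so `e_ij = e_(a₀ i)† e_(a₀ j)` exhibits the matrix of
  -- matrix units as `N* N`.
  let N : CStarMatrix A A (Matrix A A ℂ) := CStarMatrix.ofMatrix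
    (Matrix.of fun i j => if i = a₀ then matrixUnit a₀ j else 0)
  have hMN : M = star N * N := by
    ext1 i j
    rw [CStarMatrix.mul_apply, Finset.sum_eq_single a₀]
    · simp only [CStarMatrix.star_apply]
      change matrixUnit i j = star (if a₀ = a₀ then matrixUnit a₀ i else 0) *
        (if a₀ = a₀ then matrixUnit a₀ j else 0)
      simp [Matrix.star_eq_conjTranspose]
    · intro k _ hk
      change _ * (if k = a₀ then matrixUnit a₀ j else 0) = 0
      simp [hk]
    · simp
  have hM : 0 ≤ M := hMN ▸ star_mul_self_nonneg N
  have hT := CompletelyPositiveMap.map_cstarMatrix_nonneg T M hM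
  have hn : (Fintype.card A : ℂ) ≠ 0 := Nat.cast_ne_zero.2 Fintype.card_ne_zero
  have hchoi : choi T.toLinearMap = (Fintype.card A : ℝ)⁻¹ • flatten (M.map T) := by
    ext ⟨i, b⟩ ⟨j, b'⟩
    have h := choiMap_matrixUnit (choi T.toLinearMap) i j b b'
    rw [choiMap_choi] at h
    have h2 : flatten (M.map T) (i, b) (j, b') = T.toLinearMap (matrixUnit i j) b b' := rfl
    rw [Matrix.smul_apply, h2, h, Complex.real_smul]
    push_cast
    rw [inv_mul_cancel_left₀ hn]
  rw [hchoi]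
  exact (posSemidef_flatten hT).smul (by positivity)

end CompletelyPositive

/-! ### Passage to the extended reals and the decoupling theorem -/

theorem le_of_forall_two_rpow {I ε : ℝ} (h : ∀ v : ℝ, I ≤ (2 : ℝ) ^ v + ε) : I ≤ ε := by
  refine le_of_forall_pos_le_add fun η hη => ?_
  have := h (Real.logb 2 η)
  rwa [Real.rpow_logb two_pos (by norm_num) hη, add_comm] at this

/-- For finite entropies, `l` and `m` approach them from below. If one is `⊤`, the other being above
`⊥` lets `l + m` grow without bound, and `I ≤ ε` already holds. -/
theorem le_exp2_add_ofReal {I ε : ℝ} {H K : EReal} (hH : ⊥ < H) (hK : ⊥ < K) (hε : 0 ≤ ε)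
    (h : ∀ l m : ℝ, (l : EReal) < H → (m : EReal) < K → I ≤ (2 : ℝ) ^ (-(l + m) / 2) + ε) :
    ENNReal.ofReal I ≤
      exp2 (-((1 / 2 : ℝ) : EReal) * H - ((1 / 2 : ℝ) : EReal) * K) + ENNReal.ofReal ε := by
  have hhalf : (0 : ℝ) < 1 / 2 := by norm_num
  induction K using EReal.rec with
  | bot => exact absurd hK (lt_irrefl _)
  | top =>
    obtain ⟨l, -, hl⟩ := EReal.lt_iff_exists_real_btwn.1 hH
    refine le_add_left (ENNReal.ofReal_le_ofReal (le_of_forall_two_rpow fun v => ?_))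
    have := h l (-2 * v - l) hl (EReal.coe_lt_top _)
    rwa [show -(l + (-2 * v - l)) / 2 = v by ring] at this
  | coe k =>
    induction H using EReal.rec with
    | bot => exact absurd hH (lt_irrefl _)
    | top =>
      refine le_add_left (ENNReal.ofReal_le_ofReal (le_of_forall_two_rpow fun v => ?_))
      have hk : ((k - 1 : ℝ) : EReal) < k := EReal.coe_lt_coe_iff.2 (by linarith)
      have := h (-2 * v - (k - 1)) (k - 1) (EReal.coe_lt_top _) hk
      rwa [show -((-2 * v - (k - 1)) + (k - 1)) / 2 = v by ring] at this
    | coe x =>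
      have hexp : -((1 / 2 : ℝ) : EReal) * x - ((1 / 2 : ℝ) : EReal) * (k : EReal) =
          ((-(x + k) / 2 : ℝ) : EReal) := by
        rw [← EReal.coe_neg, ← EReal.coe_mul, ← EReal.coe_mul, ← EReal.coe_sub]
        congr 1
        ring
      have hexp2 : exp2 ((-(x + k) / 2 : ℝ) : EReal) =
        ENNReal.ofReal ((2 : ℝ) ^ (-(x + k) / 2)) := rfl
      rw [hexp, hexp2, ← ENNReal.ofReal_add (by positivity) hε]
      refine ENNReal.ofReal_le_ofReal ?_
      have hcont : Continuous fun δ : ℝ => (2 : ℝ) ^ (-(x + k) / 2 + δ) + ε :=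
        ((Real.continuous_const_rpow two_ne_zero).comp (continuous_const.add continuous_id)).add
          continuous_const
      have hlim := (hcont.tendsto 0).mono_left (nhdsWithin_le_nhds (s := Set.Ioi 0))
      rw [add_zero] at hlim
      refine ge_of_tendsto hlim ?_
      filter_upwards [self_mem_nhdsWithin] with δ hδ
      rw [Set.mem_Ioi] at hδ
      have := h (x - δ) (k - δ) (EReal.coe_lt_coe_iff.2 (by linarith))
        (EReal.coe_lt_coe_iff.2 (by linarith))
      rwa [show -((x - δ) + (k - δ)) / 2 = -(x + k) / 2 + δ by ring] at this

theorem decouplingError_eq {A B E : Type*} [Fintype A] [DecidableEq A] [Fintype B] [DecidableEq B]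
    [Fintype E] [DecidableEq E] [Nonempty A] (T : Matrix A A ℂ →ₗ[ℂ] Matrix B B ℂ)
    (ρ : Matrix (A × E) (A × E) ℂ) (U : Matrix.unitaryGroup A ℂ) :
    decouplingError T ρ U = traceNorm (deviation (choi T) ρ U) := by
  rw [deviation, choiMap_choi, decouplingError]

end Decoupling

theorem mainTheorem1 {A B E : Type*} [Fintype A] [DecidableEq A] [Fintype B] [DecidableEq B]
    [Fintype E] [DecidableEq E] (ε : ℝ) (hε : 0 < ε)
    (ρ : Matrix (A × E) (A × E) ℂ) (hρ : Decoupling.IsNormalized ρ)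
    (T : Matrix A A ℂ →CP Matrix B B ℂ)
    (hT : (Decoupling.choi T.toLinearMap).trace.re ≤ 1) :
    Integrable (fun U => Decoupling.decouplingError T.toLinearMap ρ U)
        (Decoupling.haarUnitary A) ∧
      ENNReal.ofReal (∫ U, Decoupling.decouplingError T.toLinearMap ρ U
          ∂(Decoupling.haarUnitary A)) ≤
        Decoupling.exp2
            (-((1 / 2 : ℝ) : EReal) * Decoupling.smoothMinEntropy ε ρ
              - ((1 / 2 : ℝ) : EReal) *
                Decoupling.smoothMinEntropy ε (Decoupling.choi T.toLinearMap))
          + ENNReal.ofReal (12 * ε) := by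
  have hAE : Nonempty (A × E) := Decoupling.nonempty_of_trace_eq_one hρ.2
  have hA : Nonempty A := hAE.map Prod.fst
  have hE : Nonempty E := hAE.map Prod.snd
  simp only [Decoupling.decouplingError_eq]
  refine ⟨Decoupling.integrable_of_continuous_real
    (Decoupling.continuous_traceNorm_deviation _ _), ?_⟩
  -- For empty `B` there is no normalized state on `B`, so the entropy of the Choi operator is `⊥`
  -- and the limiting lemma does not apply; the left side is zero.
  rcases isEmpty_or_nonempty B with hB | hB
  · have h0 : ∀ U, Decoupling.traceNorm
        (Decoupling.deviation (Decoupling.choi T.toLinearMap) ρ U) = 0 := fun U => by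
      simp [Decoupling.traceNorm, Matrix.trace]
    simp [h0]
  · have hτ : Decoupling.IsSubnormalized (Decoupling.choi T.toLinearMap) :=
      ⟨Decoupling.posSemidef_choi T, hT⟩
    have hρ' : Decoupling.IsSubnormalized ρ := ⟨hρ.1, by rw [hρ.2, Complex.one_re]⟩
    refine Decoupling.le_exp2_add_ofReal (Decoupling.bot_lt_smoothMinEntropy hρ' hε.le)
      (Decoupling.bot_lt_smoothMinEntropy hτ hε.le) (by positivity) fun l m hl hm => ?_
    have := Decoupling.integral_traceNorm_deviation_le_of_lt hτ hρ' hε.le hm hl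
    rw [add_comm m l] at this
    linarith
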